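/- Let $\Omega\subset\mathbb{R}^3$ be a bounded Lipschitz domain, $T\in(0,\infty]$, and let $\eta,\mu,\gamma>0$ be constants. Write $A:B=\sum_{j,k}A_{jk}B_{jk}$, $(\nabla v)_{jk}=\partial_k v_j$, $D(v)=\tfrac12(\nabla v+\nabla v^\top)$, $W(v)=\tfrac12(\nabla v-\nabla v^\top)$, and $\|\cdot\|_2$ for the norm of $L^2(\Omega)$. Let $L^2_\sigma(\Omega)$ be the space of $v\in L^2(\Omega)^3$ with $\operatorname{div}v=0$ in $\Omega$ and $v\cdot n=0$ on $\partial\Omega$ in the weak sense, and $L^2_\delta(\Omega)=\{S\in L^2(\Omega)^{3\times3}: S=S^\top,\ \operatorname{tr}S=0\}$. For $0<T'<T$ put $$\mathrm{LH}_{T'}=L^\infty(0,T';L^2_\sigma(\Omega))\cap L^2(0,T';H^1(\Omega)^3),\qquad \mathrm{X}_{T'}=L^\infty(0,T';L^2_\delta(\Omega))\cap L^2(0,T';H^1(\Omega)^{3\times3}),$$ $$Z_{T'}=H^1(0,T';L^2_\delta(\Omega))\cap L^2(0,T';H^1(\Omega)^{3\times3})\cap L^5(0,T';L^5(\Omega)^{3\times3}).$$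 Let $\mathcal P:L^2_\delta(\Omega)\to[0,\infty]$ be convex and lower semicontinuous with $\mathcal P(0)=0$. Let $V_0\in L^2_\sigma(\Omega)$, $S_0\in L^2_\delta(\Omega)$, $F_0\in L^1_{\mathrm{loc}}([0,T);L^2(\Omega)^3)$, $F_1\in L^2_{\mathrm{loc}}([0,T);L^2(\Omega)^{3\times3})$, and let $g$ be boundary data with $g(t)\in L^2(\partial\Omega)^3$. A pair $(V,S)$ is called a generalized solution if $(V,S)\in\mathrm{LH}_{T'}\times\mathrm{X}_{T'}$ for all $T'\in(0,T)$; $V(t)$ has the boundary trace $g(t)$ for almost every $t\in(0,T)$; $$\int_0^T\!\!\int_\Omega\big(-V\cdot\partial_t\Phi-V\otimes V:\nabla\Phi+\eta S:\nabla\Phi+\mu\nabla V:\nabla\Phi\big)\,dx\,dt=\int_0^T\!\!\int_\Omega\big(F_0\cdot\Phi-F_1:\nabla\Phi\big)\,dx\,dt+\int_\Omega V_0\cdot\Phi(\cdot,0)\,dx$$ for all divergence-free $\Phi\in C^\infty_0(\Omega\times[0,T))^3$; and, for all $T'\in(0,T)$ and all $\tilde S\in Z_{T'}$, $$\int_0^{T'}\!\!\int_\Omega\big(\partial_t\tilde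 S:(\tilde S-S)+\gamma\nabla S:\nabla(\tilde S-S)\big)\,dx\,dt+\int_0^{T'}\!\big(\mathcal P(\tilde S)-\mathcal P(S)\big)\,dt$$ $$+\int_0^{T'}\!\!\int_\Omega\big(V\cdot\nabla S:\tilde S+(S\,W(V)-W(V)\,S):\tilde S-\eta D(V):(\tilde S-S)\big)\,dx\,dt\ \ge\ -\tfrac12\|\tilde S(0)-S_0\|_2^2 .$$ Here the inequality is understood as an upper bound for $\int_0^{T'}\mathcal P(S)\,dt$ in $[0,\infty]$, with this term moved to the other side. Then every generalized solution $(V,S)$ satisfies, for almost every $T'\in(0,T)$, $$\tfrac12\|S(T')\|_2^2+\gamma\|\nabla S\|_{L^2(\Omega\times(0,T'))}^2+\int_0^{T'}\mathcal P(S)\,d\tau\ \le\ \tfrac12\|S_0\|_2^2+\int_0^{T'}\!\!\int_\Omega\eta\,D(V):S\,dx\,d\tau .$$ -/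

import Mathlib

open MeasureTheory Set Filter Topology
open scoped ContDiff

namespace ViscoFluid

/-! ### Pointwise tensor algebra -/

/-- Vectors of `ℝ³` with the Euclidean inner product. -/
abbrev Vec : Type := EuclideanSpace ℝ (Fin 3)

/-- Tensors of `ℝ^{3×3}`; the inner product is `A : B = ∑ A_{jk} B_{jk}`. -/
abbrev Ten : Type := EuclideanSpace ℝ (Fin 3 × Fin 3)

/-- The symmetric part `(M + Mᵀ)/2`. -/
noncomputable def symPart (M : Ten) : Ten :=
  WithLp.toLp 2 fun p => (M (p.1, p.2) + M (p.2, p.1)) / 2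

/-- The antisymmetric part `(M - Mᵀ)/2`. -/
noncomputable def skewPart (M : Ten) : Ten :=
  WithLp.toLp 2 fun p => (M (p.1, p.2) - M (p.2, p.1)) / 2

/-- The matrix commutator `S W - W S`. -/
noncomputable def tensorCommutator (S W : Ten) : Ten :=
  WithLp.toLp 2 fun p => ∑ j, (S (p.1, j) * W (j, p.2) - W (p.1, j) * S (j, p.2))

/-- The tensor product `(a ⊗ b)_{jk} = a_j b_k`. -/
noncomputable def tensorProd (a b : Vec) : Ten :=
  WithLp.toLp 2 fun p => a p.1 * b p.2

/-- The directional derivative `(v · ∇S)_{kl} = ∑ v_j ∂_j S_{kl}`, where `G` is the gradient of `S`,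
that is `G ((k, l), j) = ∂_j S_{kl}`. -/
noncomputable def convect (v : Vec) (G : EuclideanSpace ℝ ((Fin 3 × Fin 3) × Fin 3)) : Ten :=
  WithLp.toLp 2 fun p => ∑ j, v j * G (p, j)

/-! ### Bounded Lipschitz domains -/

/-- `Ω` is a bounded Lipschitz domain: a bounded, open, connected (hence nonempty) set that near
each of its boundary points is, in suitable Cartesian coordinates, the strict epigraph of a
Lipschitz function of two variables. -/
structure IsBoundedLipschitzDomain (Ω : Set Vec) : Prop where
  isOpen : IsOpen Ω
  isConnected : IsConnected Ω
  isBounded : Bornology.IsBounded Ω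
  exists_chart : ∀ x ∈ frontier Ω,
    ∃ (e : Vec ≃ₗᵢ[ℝ] Vec) (ψ : EuclideanSpace ℝ (Fin 2) → ℝ) (K : NNReal) (U : Set Vec),
      LipschitzWith K ψ ∧ IsOpen U ∧ x ∈ U ∧
        ∀ y ∈ U, (y ∈ Ω ↔ ψ !₂[e y 0, e y 1] < e y 2)

/-! ### Lebesgue and Sobolev spaces on `Ω` -/

/-- `L²(Ω)` for fields with values in `ℝ^ι`. -/
abbrev L2 (Ω : Set Vec) (ι : Type) [Fintype ι] : Type :=
  Lp (EuclideanSpace ℝ ι) 2 (volume.restrict Ω)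

/-- The classical gradient `(∇f)_{(i, j)} = ∂_j f_i`. -/
noncomputable def grad {ι : Type} [Fintype ι] (f : Vec → EuclideanSpace ℝ ι) (x : Vec) :
    EuclideanSpace ℝ (ι × Fin 3) :=
  WithLp.toLp 2 fun p => fderiv ℝ f x (EuclideanSpace.single p.2 1) p.1

/-- `G` is the weak gradient of `u` in `Ω`: `G_{(i, j)} = ∂_j u_i` in the sense of distributions. -/
def IsWeakGrad {Ω : Set Vec} {ι : Type} [Fintype ι] (u : L2 Ω ι) (G : L2 Ω (ι × Fin 3)) : Prop :=
  ∀ φ : Vec → ℝ, ContDiff ℝ ∞ φ → HasCompactSupport φ → tsupport φ ⊆ Ω → ∀ (i : ι) (j : Fin 3),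
    ∫ x in Ω, u x i * fderiv ℝ φ x (EuclideanSpace.single j 1) = - ∫ x in Ω, G x (i, j) * φ x

/-- `u ∈ H¹(Ω)`. -/
def MemH1 {Ω : Set Vec} {ι : Type} [Fintype ι] (u : L2 Ω ι) : Prop :=
  ∃ G : L2 Ω (ι × Fin 3), IsWeakGrad u G

open Classical in
/-- The weak gradient of `u ∈ H¹(Ω)` (and `0` for other `u`). -/
noncomputable def weakGrad {Ω : Set Vec} {ι : Type} [Fintype ι] (u : L2 Ω ι) : L2 Ω (ι × Fin 3) :=
  if h : MemH1 u then h.choose else 0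

/-- `v ∈ L²_σ(Ω)`: weakly, `div v = 0` in `Ω` and `v · n = 0` on `∂Ω`. The test functions range over
the restrictions to the closure of `Ω` of smooth functions. -/
def IsSolenoidal {Ω : Set Vec} (v : L2 Ω (Fin 3)) : Prop :=
  ∀ φ : Vec → ℝ, ContDiff ℝ ∞ φ → HasCompactSupport φ → ∫ x in Ω, fderiv ℝ φ x (v x) = 0

/-- `L²_δ(Ω)`: the square-integrable fields of symmetric, trace-free tensors. -/
noncomputable def L2dev (Ω : Set Vec) : Submodule ℝ (L2 Ω (Fin 3 × Fin 3)) where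
  carrier := {S | ∀ᵐ x ∂(volume.restrict Ω),
    (∀ i j, S x (i, j) = S x (j, i)) ∧ ∑ i, S x (i, i) = 0}
  add_mem' := by
    intro A B hA hB
    filter_upwards [hA, hB, Lp.coeFn_add A B] with x hxA hxB hx
    refine ⟨fun i j => ?_, ?_⟩
    · rw [hx]; simp [hxA.1 i j, hxB.1 i j]
    · rw [hx]; simp [Finset.sum_add_distrib, hxA.2, hxB.2]
  zero_mem' := by
    filter_upwards [Lp.coeFn_zero (EuclideanSpace ℝ (Fin 3 × Fin 3)) 2 (volume.restrict Ω)]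
      with x hx
    rw [hx]; simp
  smul_mem' := by
    intro c A hA
    filter_upwards [hA, Lp.coeFn_smul c A] with x hxA hx
    refine ⟨fun i j => ?_, ?_⟩
    · rw [hx]; simp [hxA.1 i j]
    · rw [hx]; simp [← Finset.mul_sum, hxA.2]

/-- The surface measure on `∂Ω`, up to a constant factor. -/
noncomputable def surfaceMeasure (Ω : Set Vec) : Measure Vec :=
  (Measure.hausdorffMeasure 2).restrict (frontier Ω)

/-- `h` is the boundary trace of `u ∈ H¹(Ω)³`: there are smooth functions on the closure of `Ω`
which converge to `u` in `H¹(Ω)` and whose boundary values converge to `h` in `L²(∂Ω)`. -/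
def HasTrace {Ω : Set Vec} (u : L2 Ω (Fin 3)) (h : Lp Vec 2 (surfaceMeasure Ω)) : Prop :=
  MemH1 u ∧ ∃ φ : ℕ → Vec → Vec, (∀ n, ContDiff ℝ ∞ (φ n) ∧ HasCompactSupport (φ n)) ∧
    Tendsto (fun n => eLpNorm (fun x => φ n x - u x) 2 (volume.restrict Ω)) atTop (𝓝 0) ∧
    Tendsto (fun n => eLpNorm (fun x => grad (φ n) x - weakGrad u x) 2 (volume.restrict Ω))
      atTop (𝓝 0) ∧
    Tendsto (fun n => eLpNorm (fun y => φ n y - h y) 2 (surfaceMeasure Ω)) atTop (𝓝 0)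

/-! ### Spaces of time-dependent functions -/

/-- The time interval `(0, T)`, where `T` may be infinite. -/
def timeInterval (T : EReal) : Set ℝ := {t | 0 < t ∧ (t : EReal) < T}

/-- `u ∈ L²(0, T'; H¹(Ω))`, for a given `u : (0, T') → L²(Ω)`; it is added to a condition that makes
`u` an element of `L²(0, T'; L²(Ω))`. -/
def MemL2H1 {Ω : Set Vec} {ι : Type} [Fintype ι] (T' : ℝ) (u : ℝ → L2 Ω ι) : Prop :=
  (∀ᵐ t ∂(volume.restrict (Ioo 0 T')), MemH1 (u t)) ∧
    MemLp (fun t => weakGrad (u t)) 2 (volume.restrict (Ioo 0 T'))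

/-- The Leray--Hopf class `LH_{T'} = L^∞(0, T'; L²_σ(Ω)) ∩ L²(0, T'; H¹(Ω)³)`. -/
structure MemLH {Ω : Set Vec} (T' : ℝ) (V : ℝ → L2 Ω (Fin 3)) : Prop where
  memLp : MemLp V ⊤ (volume.restrict (Ioo 0 T'))
  solenoidal : ∀ᵐ t ∂(volume.restrict (Ioo 0 T')), IsSolenoidal (V t)
  memL2H1 : MemL2H1 T' V

/-- The class `X_{T'} = L^∞(0, T'; L²_δ(Ω)) ∩ L²(0, T'; H¹(Ω)^{3×3})`. -/
structure MemX {Ω : Set Vec} (T' : ℝ) (S : ℝ → L2dev Ω) : Prop where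
  memLp : MemLp S ⊤ (volume.restrict (Ioo 0 T'))
  memL2H1 : MemL2H1 T' (fun t => (S t : L2 Ω (Fin 3 × Fin 3)))

/-- `R` is the function in the class
`Z_{T'} = H¹(0, T'; L²_δ(Ω)) ∩ L²(0, T'; H¹(Ω)^{3×3}) ∩ L⁵(0, T'; L⁵(Ω)^{3×3})`
with the weak time derivative `dR`. An element of `H¹(0, T'; L²_δ(Ω))` is identified with its unique
representative that is continuous on `[0, T']`, so that `R 0` is its initial value. -/
structure MemZ {Ω : Set Vec} (T' : ℝ) (R dR : ℝ → L2dev Ω) : Prop where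
  continuousOn : ContinuousOn R (Icc 0 T')
  memLp_deriv : MemLp dR 2 (volume.restrict (Ioo 0 T'))
  weakDeriv : ∀ θ : ℝ → ℝ, ContDiff ℝ ∞ θ → HasCompactSupport θ → tsupport θ ⊆ Ioo 0 T' →
    ∫ t in Ioo 0 T', deriv θ t • (R t : L2 Ω (Fin 3 × Fin 3)) =
      - ∫ t in Ioo 0 T', θ t • (dR t : L2 Ω (Fin 3 × Fin 3))
  memL2H1 : MemL2H1 T' (fun t => (R t : L2 Ω (Fin 3 × Fin 3)))
  memL5 : ∫⁻ t in Ioo 0 T', ∫⁻ x in Ω, ‖(R t : L2 Ω (Fin 3 × Fin 3)) x‖ₑ ^ 5 < ⊤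

/-- `Φ` is in `C^∞_{0,σ}(Ω × [0, T))`: the restriction to times `t ≥ 0` of a smooth function with
compact support in `Ω × (-∞, T)`, solenoidal at all times `t ≥ 0`. -/
structure IsTestVelocity (Ω : Set Vec) (T : EReal) (Φ : ℝ → Vec → Vec) : Prop where
  contDiff : ContDiff ℝ ∞ (fun p : ℝ × Vec => Φ p.1 p.2)
  hasCompactSupport : HasCompactSupport (fun p : ℝ × Vec => Φ p.1 p.2)
  tsupport_subset : tsupport (fun p : ℝ × Vec => Φ p.1 p.2) ⊆ {p | (p.1 : EReal) < T ∧ p.2 ∈ Ω}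
  div_eq_zero : ∀ t, 0 ≤ t → ∀ x, ∑ i, grad (Φ t) x (i, i) = 0

/-! ### The fluid model -/

/-- Dissipation potentials: `P : L²_δ(Ω) → [0, ∞]` is convex and lower semicontinuous with
`P(0) = 0`. -/
structure IsPotential {Ω : Set Vec} (P : L2dev Ω → ENNReal) : Prop where
  convex : ∀ (A B : L2dev Ω) (θ : ℝ), 0 ≤ θ → θ ≤ 1 →
    P (θ • A + (1 - θ) • B) ≤ ENNReal.ofReal θ * P A + ENNReal.ofReal (1 - θ) * P B
  lowerSemicontinuous : LowerSemicontinuous P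
  map_zero : P 0 = 0

/-- The momentum equation in weak form, with initial value `V₀` and force `F₀ + Div F₁`. -/
def WeakMomentum {Ω : Set Vec} (T : EReal) (η μ : ℝ) (V₀ : L2 Ω (Fin 3)) (F₀ : ℝ → L2 Ω (Fin 3))
    (F₁ : ℝ → L2 Ω (Fin 3 × Fin 3)) (V : ℝ → L2 Ω (Fin 3)) (S : ℝ → L2dev Ω) : Prop :=
  ∀ Φ : ℝ → Vec → Vec, IsTestVelocity Ω T Φ →
    ∫ t in timeInterval T, ∫ x in Ω,
        (- inner ℝ (V t x) (deriv (fun s => Φ s x) t)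
          - inner ℝ (tensorProd (V t x) (V t x)) (grad (Φ t) x)
          + η * inner ℝ ((S t : L2 Ω (Fin 3 × Fin 3)) x) (grad (Φ t) x)
          + μ * inner ℝ (weakGrad (V t) x) (grad (Φ t) x)) =
      (∫ t in timeInterval T, ∫ x in Ω, inner ℝ (F₀ t x) (Φ t x))
        - (∫ t in timeInterval T, ∫ x in Ω, inner ℝ (F₁ t x) (grad (Φ t) x))
        + ∫ x in Ω, inner ℝ (V₀ x) (Φ 0 x)

/-- The evolutionary variational inequality on `(0, T')` for the stress, tested with `R`, whose time
derivative is `dR`. The term `∫ P(S)` is on the smaller side, so that no difference of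
infinite values occurs; every other term, apart from `∫ P(R)`, is a finite real number. -/
def VariationalIneq {Ω : Set Vec} (η γ : ℝ) (P : L2dev Ω → ENNReal) (S₀ : L2dev Ω)
    (V : ℝ → L2 Ω (Fin 3)) (S : ℝ → L2dev Ω) (T' : ℝ) (R dR : ℝ → L2dev Ω) : Prop :=
  ((∫⁻ t in Ioo 0 T', P (S t) : ENNReal) : EReal) ≤
    ((∫⁻ t in Ioo 0 T', P (R t) : ENNReal) : EReal) +
    (((∫ t in Ioo 0 T', ∫ x in Ω,
        (inner ℝ ((dR t : L2 Ω (Fin 3 × Fin 3)) x)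
            ((R t : L2 Ω (Fin 3 × Fin 3)) x - (S t : L2 Ω (Fin 3 × Fin 3)) x)
          + γ * inner ℝ (weakGrad (S t : L2 Ω (Fin 3 × Fin 3)) x)
            (weakGrad (R t : L2 Ω (Fin 3 × Fin 3)) x - weakGrad (S t : L2 Ω (Fin 3 × Fin 3)) x)))
      + (∫ t in Ioo 0 T', ∫ x in Ω,
        (inner ℝ (convect (V t x) (weakGrad (S t : L2 Ω (Fin 3 × Fin 3)) x))
            ((R t : L2 Ω (Fin 3 × Fin 3)) x)
          + inner ℝ (tensorCommutator ((S t : L2 Ω (Fin 3 × Fin 3)) x) (skewPart (weakGrad (V t) x)))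
            ((R t : L2 Ω (Fin 3 × Fin 3)) x)
          - η * inner ℝ (symPart (weakGrad (V t) x))
            ((R t : L2 Ω (Fin 3 × Fin 3)) x - (S t : L2 Ω (Fin 3 × Fin 3)) x)))
      + 1 / 2 * ‖R 0 - S₀‖ ^ 2 : ℝ) : EReal)

/-- `(V, S)` is a generalized solution on `(0, T)` of the viscoelastoplastic fluid model with
initial values `V₀`, `S₀`, force `F₀ + Div F₁` and boundary velocity `g`. -/
structure IsGeneralizedSolution {Ω : Set Vec} (T : EReal) (η μ γ : ℝ) (P : L2dev Ω → ENNReal)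
    (V₀ : L2 Ω (Fin 3)) (S₀ : L2dev Ω) (F₀ : ℝ → L2 Ω (Fin 3)) (F₁ : ℝ → L2 Ω (Fin 3 × Fin 3))
    (g : ℝ → Lp Vec 2 (surfaceMeasure Ω)) (V : ℝ → L2 Ω (Fin 3)) (S : ℝ → L2dev Ω) : Prop where
  memLH : ∀ T' ∈ timeInterval T, MemLH T' V
  memX : ∀ T' ∈ timeInterval T, MemX T' S
  boundary : ∀ᵐ t ∂(volume.restrict (timeInterval T)), HasTrace (V t) (g t)
  momentum : WeakMomentum T η μ V₀ F₀ F₁ V S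
  variational : ∀ T' ∈ timeInterval T, ∀ R dR : ℝ → L2dev Ω, MemZ T' R dR →
    VariationalIneq η γ P S₀ V S T' R dR

end ViscoFluid

open ViscoFluid

/-!
Fix `b = T'` and let `ρ` vanish on `[0, a]` and rise linearly from `0` to `1` on `[a, b]`. Testing
the variational inequality with `ρ(t) S(b)` is an approximation of testing with `0`. Since
`∫ ρ' ρ = 1/2`, the time derivative contributes `½‖S(b)‖² - ⟨S(b), ⨍ S⟩`, where the mean over
`(a, b)` tends to `S(b)` as `a → b` whenever `b` is a Lebesgue point of `S`; this produces
`-½‖S(b)‖²`. The value at time `0` is `0`, so the initial term is `½‖S₀‖²`. By convexity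
`∫ P(ρ S(b)) ≤ (b - a) P(S(b))`, and every other term containing the test function has a factor `ρ`
and an integrable cofactor, so it vanishes in the limit.

The test function is admissible, and the trilinear cofactors are integrable, because `H¹(Ω)` embeds
into `L^q(Ω)` for `q < 6`. Near a boundary point `Ω` contains a translate of one fixed cone at each
of its points, so `u` can be compared with its averages over shrinking cones; the difference is
dominated by the convolution of `|∇u|` with `|y|⁻²`, to which Young's inequality applies.
-/

namespace ViscoFluid

/-! ### Averages over shrinking cones -/

section ConeAverage

variable {E : Type*} [NormedAddCommGroup E] [InnerProductSpace ℝ E]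

/-- The kernel `y ↦ s⁻ᵈ κ((y - x) / s)`, where `d` is the dimension of the space. -/
noncomputable def scaledKernel (κ : E → ℝ) (x : E) (s : ℝ) (y : E) : ℝ :=
  s⁻¹ ^ Module.finrank ℝ E * κ (s⁻¹ • (y - x))

/-- The vector field whose divergence is the negative `s`-derivative of `scaledKernel κ x s`. -/
noncomputable def scaledField (κ : E → ℝ) (x : E) (s : ℝ) (y : E) : E :=
  (s⁻¹ * scaledKernel κ x s y) • (y - x)

/-- The divergence of the vector field `X`, as the trace of its derivative. -/
noncomputable def divergence (X : E → E) (x : E) : ℝ :=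
  LinearMap.trace ℝ E (fderiv ℝ X x : E →ₗ[ℝ] E)

/-- `g` is the weak gradient of the scalar function `f` in `Ω`, tested along all constant vectors
`v` instead of the coordinate directions. -/
def HasWeakGradient [MeasurableSpace E] (μ : Measure E) (Ω : Set E) (f : E → ℝ) (g : E → E) :
    Prop :=
  ∀ φ : E → ℝ, ContDiff ℝ ∞ φ → HasCompactSupport φ → tsupport φ ⊆ Ω → ∀ v : E,
    ∫ x in Ω, f x * fderiv ℝ φ x v ∂μ = -∫ x in Ω, inner ℝ v (g x) * φ x ∂μ

theorem continuous_scaledKernel {κ : E → ℝ} (hκ : Continuous κ) (x : E) (s : ℝ) :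
    Continuous (scaledKernel κ x s) := by
  unfold scaledKernel
  fun_prop

theorem abs_scaledKernel_le {κ : E → ℝ} {M : ℝ} (hM : ∀ z, |κ z| ≤ M) (x : E) {s : ℝ}
    (hs : 0 < s) (y : E) : |scaledKernel κ x s y| ≤ s⁻¹ ^ Module.finrank ℝ E * M := by
  rw [scaledKernel, abs_mul, abs_of_pos (by positivity)]
  gcongr
  exact hM _

theorem contDiff_scaledField {κ : E → ℝ} (hκ : ContDiff ℝ ∞ κ) (x : E) (s : ℝ) :
    ContDiff ℝ ∞ (scaledField κ x s) := by
  unfold scaledField scaledKernel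
  fun_prop

theorem support_scaledKernel_subset (κ : E → ℝ) (x : E) {s : ℝ} (hs : s ≠ 0) :
    Function.support (scaledKernel κ x s) ⊆ (fun w => x + s • w) '' Function.support κ :=
  fun y hy => ⟨s⁻¹ • (y - x), right_ne_zero_of_mul hy, by simp [smul_smul, hs]⟩

theorem support_scaledField_subset (κ : E → ℝ) (x : E) (s : ℝ) :
    Function.support (scaledField κ x s) ⊆ Function.support (scaledKernel κ x s) := by
  intro y hy hy0
  exact hy (by simp [scaledField, hy0])

theorem support_scaledKernel_subset_closedBall {κ : E → ℝ} {R : ℝ}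
    (hsupp : Function.support κ ⊆ Metric.closedBall 0 R) (x : E) {s : ℝ} (hs : 0 < s) :
    Function.support (scaledKernel κ x s) ⊆ Metric.closedBall x (R * s) := by
  refine (support_scaledKernel_subset κ x hs.ne').trans ?_
  rintro _ ⟨w, hw, rfl⟩
  have hwR : ‖w‖ ≤ R := mem_closedBall_zero_iff.1 (hsupp hw)
  rw [mem_closedBall_iff_norm, add_sub_cancel_left, norm_smul, Real.norm_of_nonneg hs.le, mul_comm]
  gcongr

theorem norm_scaledField_le {κ : E → ℝ} {M R : ℝ} (hM : ∀ z, |κ z| ≤ M) (hR : 0 ≤ R)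
    (hsupp : Function.support κ ⊆ Metric.closedBall 0 R) (x : E) {s : ℝ} (hs : 0 < s) (y : E) :
    ‖scaledField κ x s y‖ ≤ s⁻¹ ^ Module.finrank ℝ E * M * R := by
  have hM0 : 0 ≤ M := (abs_nonneg _).trans (hM 0)
  by_cases hy : scaledKernel κ x s y = 0
  · simp only [scaledField, hy, mul_zero, zero_smul, norm_zero]
    positivity
  have hyR : ‖y - x‖ ≤ R * s :=
    mem_closedBall_iff_norm.1 (support_scaledKernel_subset_closedBall hsupp x hs hy)
  calc ‖scaledField κ x s y‖ = s⁻¹ * |scaledKernel κ x s y| * ‖y - x‖ := by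
        rw [scaledField, norm_smul, Real.norm_eq_abs, abs_mul, abs_of_pos (inv_pos.2 hs)]
    _ ≤ s⁻¹ * (s⁻¹ ^ Module.finrank ℝ E * M) * (R * s) := by
        gcongr
        exact abs_scaledKernel_le hM x hs y
    _ = s⁻¹ ^ Module.finrank ℝ E * M * R := by field_simp

theorem tsupport_scaledField_subset {κ : E → ℝ} (hc : HasCompactSupport κ) (x : E) {s : ℝ}
    (hs : s ≠ 0) : tsupport (scaledField κ x s) ⊆ (fun w => x + s • w) '' tsupport κ := by
  have hK : IsCompact ((fun w : E => x + s • w) '' tsupport κ) := hc.isCompact.image (by fun_prop)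
  refine closure_minimal ?_ hK.isClosed
  exact (support_scaledField_subset κ x s).trans
    ((support_scaledKernel_subset κ x hs).trans (image_mono (subset_tsupport κ)))

theorem hasCompactSupport_scaledField {κ : E → ℝ} (hc : HasCompactSupport κ) (x : E) {s : ℝ}
    (hs : s ≠ 0) : HasCompactSupport (scaledField κ x s) :=
  (hc.isCompact.image (by fun_prop : Continuous fun w : E => x + s • w)).of_isClosed_subset
    (isClosed_tsupport _) (tsupport_scaledField_subset hc x hs)

theorem divergence_scaledField [FiniteDimensional ℝ E] {κ : E → ℝ} (hκ : Differentiable ℝ κ)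
    (x : E) (s : ℝ) (y : E) :
    divergence (scaledField κ x s) y = s⁻¹ ^ (Module.finrank ℝ E + 1) *
      (Module.finrank ℝ E * κ (s⁻¹ • (y - x)) +
        fderiv ℝ κ (s⁻¹ • (y - x)) (s⁻¹ • (y - x))) := by
  have hsub : HasFDerivAt (fun y : E => y - x) (ContinuousLinearMap.id ℝ E) y :=
    (hasFDerivAt_id y).sub_const x
  have hκs := ((hκ (s⁻¹ • (y - x))).hasFDerivAt.comp y (hsub.const_smul s⁻¹)).const_mul
    (s⁻¹ * s⁻¹ ^ Module.finrank ℝ E)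
  have hfield : HasFDerivAt (scaledField κ x s) _ y :=
    (hκs.smul hsub).congr_of_eventuallyEq (Eventually.of_forall fun z => by
      simp [scaledField, scaledKernel, mul_assoc])
  rw [divergence, hfield.fderiv]
  simp
  ring

theorem hasDerivAt_scaledKernel [FiniteDimensional ℝ E] {κ : E → ℝ} (hκ : Differentiable ℝ κ)
    (x y : E) {s : ℝ} (hs : s ≠ 0) :
    HasDerivAt (fun s => scaledKernel κ x s y) (-divergence (scaledField κ x s) y) s := by
  have hinv : HasDerivAt (fun s : ℝ => s⁻¹) (-(s ^ 2)⁻¹) s := hasDerivAt_inv hs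
  have hκs := (hκ (s⁻¹ • (y - x))).hasFDerivAt.comp_hasDerivAt s (hinv.smul_const (y - x))
  refine ((hinv.fun_pow (Module.finrank ℝ E)).fun_mul hκs).congr_deriv ?_
  rw [divergence_scaledField hκ]
  generalize Module.finrank ℝ E = d
  rcases d with _ | d <;> simp <;> field_simp
  ring

theorem exists_bound_divergence_scaledField [FiniteDimensional ℝ E] {κ : E → ℝ}
    (hκ : ContDiff ℝ ∞ κ) (hc : HasCompactSupport κ) {s₀ : ℝ} (hs₀ : 0 < s₀) :
    ∃ C, ∀ x y s, s₀ ≤ s → ‖divergence (scaledField κ x s) y‖ ≤ C := by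
  have hcont : Continuous fun z => Module.finrank ℝ E * κ z + fderiv ℝ κ z z :=
    (continuous_const.mul hκ.continuous).add
      ((hκ.continuous_fderiv (by simp)).clm_apply continuous_id)
  have hcs : HasCompactSupport fun z => Module.finrank ℝ E * κ z + fderiv ℝ κ z z :=
    (hc.mul_left).add ((hc.fderiv ℝ).mono fun z hz h => hz (by simp [h]))
  obtain ⟨C, hC⟩ := hcs.exists_bound_of_continuous hcont
  refine ⟨s₀⁻¹ ^ (Module.finrank ℝ E + 1) * C, fun x y s hs => ?_⟩
  have hs' : 0 < s := hs₀.trans_le hs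
  rw [divergence_scaledField (hκ.differentiable (by simp)), norm_mul,
    Real.norm_of_nonneg (by positivity)]
  gcongr
  exact hC _

theorem continuous_divergence [FiniteDimensional ℝ E] {X : E → E} (hX : ContDiff ℝ ∞ X) :
    Continuous (divergence X) := by
  unfold divergence
  have := hX.continuous_fderiv (by simp)
  let L : (E →L[ℝ] E) →ₗ[ℝ] ℝ :=
    (LinearMap.trace ℝ E).comp (ContinuousLinearMap.coeLM ℝ)
  exact (L.continuous_of_finiteDimensional).comp this

section Measure

variable [FiniteDimensional ℝ E] [MeasurableSpace E] [BorelSpace E] {μ : Measure E}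

theorem hasDerivAt_integral_scaledKernel {κ : E → ℝ} (hκ : ContDiff ℝ ∞ κ)
    (hc : HasCompactSupport κ) {f : E → ℝ} (hf : Integrable f μ) (x : E) {s : ℝ} (hs : 0 < s) :
    HasDerivAt (fun s => ∫ y, scaledKernel κ x s y * f y ∂μ)
      (∫ y, -divergence (scaledField κ x s) y * f y ∂μ) s := by
  obtain ⟨C, hC⟩ := exists_bound_divergence_scaledField hκ hc (half_pos hs)
  obtain ⟨M, hM⟩ := hc.exists_bound_of_continuous hκ.continuous
  have hmeas (t : ℝ) : AEStronglyMeasurable (scaledKernel κ x t) μ :=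
    (continuous_scaledKernel hκ.continuous x t).aestronglyMeasurable
  refine (hasDerivAt_integral_of_dominated_loc_of_deriv_le (bound := fun y => C * ‖f y‖)
    (F := fun s y => scaledKernel κ x s y * f y)
    (F' := fun s y => -divergence (scaledField κ x s) y * f y)
    (Ioi_mem_nhds (half_lt_self hs)) (Eventually.of_forall fun t => (hmeas t).mul hf.1)
    (hf.bdd_mul (hmeas s) (Eventually.of_forall fun y => abs_scaledKernel_le hM x hs y))
    ((continuous_divergence (contDiff_scaledField hκ x s)).neg.aestronglyMeasurable.mul hf.1)
    ?_ (hf.norm.const_mul _) ?_).2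
  · refine Eventually.of_forall fun y t ht => ?_
    rw [norm_mul, norm_neg]
    gcongr
    exact hC _ _ _ (le_of_lt ht)
  · exact Eventually.of_forall fun y t ht => (hasDerivAt_scaledKernel
      (hκ.differentiable (by simp)) x y ((half_pos hs).trans ht).ne').mul_const _

theorem HasWeakGradient.integral_mul_divergence {Ω : Set E} {f : E → ℝ} {g : E → E}
    (h : HasWeakGradient μ Ω f g) (hf : IntegrableOn f Ω μ) (hg : IntegrableOn g Ω μ) {X : E → E}
    (hX : ContDiff ℝ ∞ X) (hc : HasCompactSupport X) (hsub : tsupport X ⊆ Ω) :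
    ∫ y in Ω, f y * divergence X y ∂μ = -∫ y in Ω, inner ℝ (X y) (g y) ∂μ := by
  let b := stdOrthonormalBasis ℝ E
  have hb (j) : ContDiff ℝ ∞ fun y => inner ℝ (b j) (X y) := contDiff_const.inner ℝ hX
  have hbsupp (j) : Function.support (fun y => inner ℝ (b j) (X y)) ⊆ Function.support X :=
    fun y hy hy0 => hy (by simp [hy0])
  have hbc (j) : HasCompactSupport fun y => inner ℝ (b j) (X y) := hc.mono (hbsupp j)
  have hdiv (y : E) : divergence X y =
      ∑ j, fderiv ℝ (fun y => inner ℝ (b j) (X y)) y (b j) := by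
    rw [divergence, LinearMap.trace_eq_sum_inner _ b]
    refine Finset.sum_congr rfl fun j _ => ?_
    rw [fderiv_inner_apply ℝ (by fun_prop) (hX.differentiable (by simp) y)]
    simp
  have hinner (y : E) : inner ℝ (X y) (g y) = ∑ j, inner ℝ (b j) (g y) * inner ℝ (b j) (X y) := by
    rw [← b.sum_inner_mul_inner]
    exact Finset.sum_congr rfl fun j _ => by rw [real_inner_comm (b j) (X y), mul_comm]
  have hint₁ (j) : IntegrableOn
      (fun y => f y * fderiv ℝ (fun y => inner ℝ (b j) (X y)) y (b j)) Ω μ := by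
    have hcont : Continuous fun y => fderiv ℝ (fun y => inner ℝ (b j) (X y)) y (b j) :=
      ((hb j).continuous_fderiv (by simp)).clm_apply continuous_const
    obtain ⟨C, hC⟩ := ((hbc j).fderiv_apply (𝕜 := ℝ) (b j)).exists_bound_of_continuous hcont
    exact hf.mul_bdd hcont.aestronglyMeasurable (Eventually.of_forall hC)
  have hint₂ (j) : IntegrableOn (fun y => inner ℝ (b j) (g y) * inner ℝ (b j) (X y)) Ω μ := by
    obtain ⟨C, hC⟩ := (hbc j).exists_bound_of_continuous (hb j).continuous
    exact (hg.const_inner (b j)).mul_bdd (hb j).continuous.aestronglyMeasurable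
      (Eventually.of_forall hC)
  simp_rw [hdiv, hinner, Finset.mul_sum]
  rw [integral_finsetSum _ fun j _ => hint₁ j, integral_finsetSum _ fun j _ => hint₂ j,
    ← Finset.sum_neg_distrib]
  exact Finset.sum_congr rfl fun j _ =>
    h _ (hb j) (hbc j) ((closure_mono (hbsupp j)).trans hsub) (b j)

end Measure

end ConeAverage

section BallIntegral

variable {E : Type*} [NormedAddCommGroup E] [MeasurableSpace E] [BorelSpace E] {μ : Measure E}
  {G : E → ENNReal}

theorem lintegral_closedBall_eq (G : E → ENNReal) (r : ℝ) (x : E) :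
    ∫⁻ y in Metric.closedBall x r, G y ∂μ =
      ∫⁻ y, {z : E × E | dist z.2 z.1 ≤ r}.indicator (fun z => G z.2) (x, y) ∂μ := by
  rw [← lintegral_indicator measurableSet_closedBall]
  rfl

theorem lintegral_closedBall_le_eLpNorm_restrict [μ.IsAddHaarMeasure] (hG : AEMeasurable G μ)
    {p : NNReal} (hp : 1 ≤ p) (r : ℝ) (x : E) :
    ∫⁻ y in Metric.closedBall x r, G y ∂μ ≤ μ (Metric.closedBall 0 r) ^ (1 - (p : ℝ)⁻¹) *
      eLpNorm G p (μ.restrict (Metric.closedBall x r)) := by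
  have h := eLpNorm_le_eLpNorm_mul_rpow_measure_univ (p := 1) (q := p) (by exact_mod_cast hp)
    (hG.mono_measure (Measure.restrict_le_self (s := Metric.closedBall x r))).aestronglyMeasurable
  rw [eLpNorm_one_eq_lintegral_enorm] at h
  simpa [Measure.addHaar_closedBall_center μ x r, mul_comm] using h

variable [SecondCountableTopology E]

theorem aemeasurable_indicator_dist_le (hG : AEMeasurable G μ) (r : ℝ) :
    AEMeasurable ({z : E × E | dist z.2 z.1 ≤ r}.indicator fun z => G z.2) (μ.prod μ) :=
  hG.comp_snd.indicator
    (measurableSet_le (measurable_snd.dist measurable_fst) measurable_const)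

variable [SFinite μ]

theorem aemeasurable_lintegral_closedBall (hG : AEMeasurable G μ) (r : ℝ) :
    AEMeasurable (fun x => ∫⁻ y in Metric.closedBall x r, G y ∂μ) μ := by
  simp_rw [lintegral_closedBall_eq]
  exact (aemeasurable_indicator_dist_le hG r).lintegral_prod_right'

theorem lintegral_lintegral_closedBall [μ.IsAddHaarMeasure] (hG : AEMeasurable G μ) (r : ℝ) :
    ∫⁻ x, ∫⁻ y in Metric.closedBall x r, G y ∂μ ∂μ =
      μ (Metric.closedBall 0 r) * ∫⁻ y, G y ∂μ := by
  simp_rw [lintegral_closedBall_eq]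
  rw [lintegral_lintegral_swap
    (f := fun x y => {z : E × E | dist z.2 z.1 ≤ r}.indicator (fun z => G z.2) (x, y))
    (aemeasurable_indicator_dist_le hG r), ← lintegral_const_mul'' _ hG]
  congr 1 with y
  have hsection : (fun x => {z : E × E | dist z.2 z.1 ≤ r}.indicator (fun z => G z.2) (x, y)) =
      (Metric.closedBall y r).indicator fun _ => G y := by
    ext x
    simp only [indicator, mem_ofPred_eq, Metric.mem_closedBall, dist_comm x y]
  rw [hsection, lintegral_indicator measurableSet_closedBall, setLIntegral_const,
    Measure.addHaar_closedBall_center, mul_comm]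

theorem eLpNorm_lintegral_closedBall_le_self [μ.IsAddHaarMeasure] (hG : AEMeasurable G μ)
    {p : NNReal} (hp : 1 ≤ p) (r : ℝ) :
    eLpNorm (fun x => ∫⁻ y in Metric.closedBall x r, G y ∂μ) p μ ≤
      μ (Metric.closedBall 0 r) * eLpNorm G p μ := by
  have hp0 : 0 < (p : ℝ) := zero_lt_one.trans_le (by exact_mod_cast hp)
  have hp0' : p ≠ 0 := fun h => by simp [h] at hp0
  set m := μ (Metric.closedBall 0 r)
  rw [← ENNReal.rpow_le_rpow_iff hp0, ENNReal.mul_rpow_of_nonneg _ _ hp0.le,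
    eLpNorm_nnreal_pow_eq_lintegral hp0', eLpNorm_nnreal_pow_eq_lintegral hp0']
  simp only [enorm_eq_self]
  calc ∫⁻ x, (∫⁻ y in Metric.closedBall x r, G y ∂μ) ^ (p : ℝ) ∂μ
      ≤ ∫⁻ x, m ^ (p - 1 : ℝ) * ∫⁻ y in Metric.closedBall x r, G y ^ (p : ℝ) ∂μ ∂μ := by
        refine lintegral_mono fun x => (ENNReal.rpow_le_rpow
          (lintegral_closedBall_le_eLpNorm_restrict hG hp r x) hp0.le).trans_eq ?_
        rw [ENNReal.mul_rpow_of_nonneg _ _ hp0.le, eLpNorm_nnreal_pow_eq_lintegral hp0',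
          ← ENNReal.rpow_mul, sub_mul, inv_mul_cancel₀ hp0.ne', one_mul]
        simp only [enorm_eq_self, m]
    _ = m ^ (p - 1 : ℝ) * m ^ (1 : ℝ) * ∫⁻ y, G y ^ (p : ℝ) ∂μ := by
        rw [lintegral_const_mul'' _ (aemeasurable_lintegral_closedBall (hG.pow_const _) r),
          lintegral_lintegral_closedBall (hG.pow_const _), ENNReal.rpow_one, mul_assoc]
    _ = m ^ (p : ℝ) * ∫⁻ y, G y ^ (p : ℝ) ∂μ := by
        rw [← ENNReal.rpow_add_of_nonneg _ _ (by simpa using hp) zero_le_one, sub_add_cancel]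

theorem eLpNorm_le_of_ae_enorm_le {α ε : Type*} [MeasurableSpace α] [TopologicalSpace ε]
    [ContinuousENorm ε] {μ : Measure α} {p q : NNReal} (hp : p ≠ 0) (hpq : p ≤ q) {f : α → ε}
    (hf : AEStronglyMeasurable f μ) {K : ENNReal} (hK : ∀ᵐ x ∂μ, ‖f x‖ₑ ≤ K) :
    eLpNorm f q μ ≤ K ^ (1 - p / q : ℝ) * eLpNorm f p μ ^ (p / q : ℝ) := by
  have hp0 : 0 < (p : ℝ) := by exact_mod_cast hp.pos
  have hpq' : (p : ℝ) ≤ q := by exact_mod_cast hpq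
  have hq0 : 0 < (q : ℝ) := hp0.trans_le hpq'
  have hq : q ≠ 0 := fun h => by simp [h] at hq0
  rw [← ENNReal.rpow_le_rpow_iff hq0, ENNReal.mul_rpow_of_nonneg _ _ hq0.le, ← ENNReal.rpow_mul,
    ← ENNReal.rpow_mul, sub_mul, div_mul_cancel₀ _ hq0.ne', one_mul,
    eLpNorm_nnreal_pow_eq_lintegral hq, eLpNorm_nnreal_pow_eq_lintegral hp]
  rw [← lintegral_const_mul'' _ (hf.enorm.pow_const _)]
  refine lintegral_mono_ae ?_
  filter_upwards [hK] with x hx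
  calc ‖f x‖ₑ ^ (q : ℝ) = ‖f x‖ₑ ^ (q - p : ℝ) * ‖f x‖ₑ ^ (p : ℝ) := by
        rw [← ENNReal.rpow_add_of_nonneg _ _ (by linarith) hp0.le, sub_add_cancel]
    _ ≤ K ^ (q - p : ℝ) * ‖f x‖ₑ ^ (p : ℝ) := by gcongr

/-- Integration over balls of radius `r` is a convolution, so this is Young's inequality. -/
theorem eLpNorm_lintegral_closedBall_le [μ.IsAddHaarMeasure] (hG : AEMeasurable G μ)
    {p q : NNReal} (hp : 1 ≤ p) (hpq : p ≤ q) (r : ℝ) :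
    eLpNorm (fun x => ∫⁻ y in Metric.closedBall x r, G y ∂μ) q μ ≤
      μ (Metric.closedBall 0 r) ^ (1 - (p : ℝ)⁻¹ + (q : ℝ)⁻¹) * eLpNorm G p μ := by
  have hp1 : 1 ≤ (p : ℝ) := by exact_mod_cast hp
  have hpq' : (p : ℝ) ≤ q := by exact_mod_cast hpq
  have hp0 : 0 < (p : ℝ) := by linarith
  have hq0 : 0 < (q : ℝ) := by linarith
  have hθ : (p / q : ℝ) ≤ 1 := (div_le_one hq0).2 hpq'
  have hinv : (p : ℝ)⁻¹ ≤ 1 := inv_le_one_of_one_le₀ hp1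
  set m := μ (Metric.closedBall 0 r)
  set N := eLpNorm G p μ
  have hsup (x : E) : ‖∫⁻ y in Metric.closedBall x r, G y ∂μ‖ₑ ≤ m ^ (1 - (p : ℝ)⁻¹) * N :=
    (lintegral_closedBall_le_eLpNorm_restrict hG hp r x).trans
      (by gcongr; exact eLpNorm_mono_measure _ Measure.restrict_le_self)
  calc eLpNorm (fun x => ∫⁻ y in Metric.closedBall x r, G y ∂μ) q μ
      ≤ (m ^ (1 - (p : ℝ)⁻¹) * N) ^ (1 - p / q : ℝ) * (m * N) ^ (p / q : ℝ) := by
        refine (eLpNorm_le_of_ae_enorm_le (fun h => by simp [h] at hp0) hpq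
          (aemeasurable_lintegral_closedBall hG r).aestronglyMeasurable (ae_of_all _ hsup)).trans ?_
        gcongr
        exact eLpNorm_lintegral_closedBall_le_self hG hp r
    _ = m ^ ((1 - (p : ℝ)⁻¹) * (1 - p / q) + p / q) * N ^ ((1 - p / q) + p / q : ℝ) := by
        rw [ENNReal.mul_rpow_of_nonneg _ _ (by linarith), ENNReal.mul_rpow_of_nonneg _ _
          (by positivity), ← ENNReal.rpow_mul, ENNReal.rpow_add_of_nonneg _ _
          (mul_nonneg (by linarith) (by linarith)) (by positivity),
          ENNReal.rpow_add_of_nonneg _ _ (by linarith) (by positivity)]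
        ring
    _ = m ^ (1 - (p : ℝ)⁻¹ + (q : ℝ)⁻¹) * N := by
        congr 2
        · field_simp; ring
        · simp

end BallIntegral

section ConeAverage

variable {E : Type*} [NormedAddCommGroup E] [InnerProductSpace ℝ E] [FiniteDimensional ℝ E]
  [MeasurableSpace E] [BorelSpace E] {μ : Measure E} [μ.IsAddHaarMeasure]

theorem addHaar_closedBall_rpow {R s : ℝ} (hR : 0 ≤ R) (hs : 0 ≤ s) {θ : ℝ} (hθ : 0 ≤ θ) :
    μ (Metric.closedBall (0 : E) (R * s)) ^ θ =
      ENNReal.ofReal (s ^ (Module.finrank ℝ E * θ)) * μ (Metric.closedBall (0 : E) R) ^ θ := by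
  rw [mul_comm, Measure.addHaar_closedBall_mul _ _ hs hR, ENNReal.mul_rpow_of_nonneg _ _ hθ,
    ENNReal.ofReal_rpow_of_nonneg (by positivity) hθ, Real.rpow_mul hs, Real.rpow_natCast]

end ConeAverage

theorem enorm_integral_inner_le_of_norm_le {E F : Type*} [SeminormedAddCommGroup E]
    [MeasurableSpace E] [OpensMeasurableSpace E] [NormedAddCommGroup F] [InnerProductSpace ℝ F]
    {μ : Measure E} {Ω : Set E} (hΩ : MeasurableSet Ω) {X g : E → F} {x : E} {r C : ℝ}
    (hX : Function.support X ⊆ Metric.closedBall x r) (hC : ∀ y, ‖X y‖ ≤ C) :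
    ‖∫ y in Ω, inner ℝ (X y) (g y) ∂μ‖ₑ ≤
      ENNReal.ofReal C * ∫⁻ y in Metric.closedBall x r, Ω.indicator (fun y => ‖g y‖ₑ) y ∂μ := by
  refine (enorm_integral_le_lintegral_enorm _).trans ?_
  rw [← lintegral_const_mul' _ _ ENNReal.ofReal_ne_top, ← lintegral_indicator hΩ,
    ← lintegral_indicator measurableSet_closedBall]
  refine lintegral_mono fun y => ?_
  by_cases hy : y ∈ Ω ∧ X y ≠ 0
  · rw [indicator_of_mem hy.1, indicator_of_mem (hX hy.2), indicator_of_mem hy.1]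
    calc ‖(inner ℝ (X y) (g y) : ℝ)‖ₑ ≤ ‖X y‖ₑ * ‖g y‖ₑ := by
          simpa only [enorm_eq_nnnorm, ← ENNReal.coe_mul, ENNReal.coe_le_coe]
            using nnnorm_inner_le_nnnorm (𝕜 := ℝ) (X y) (g y)
      _ ≤ ENNReal.ofReal C * ‖g y‖ₑ := by
          gcongr
          exact (ofReal_norm (X y)).symm.trans_le (ENNReal.ofReal_le_ofReal (hC y))
  · suffices Ω.indicator (fun y => ‖(inner ℝ (X y) (g y) : ℝ)‖ₑ) y = 0 by simp [this]
    simp only [not_and_not_right] at hy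
    by_cases hyΩ : y ∈ Ω
    · simp [hyΩ, hy hyΩ]
    · simp [hyΩ]

theorem enorm_sub_le_of_enorm_deriv_le {F : Type*} [NormedAddCommGroup F] [NormedSpace ℝ F]
    {m m' : ℝ → F} {a b : ℝ} (hab : a ≤ b) {C : ENNReal}
    (hd : ∀ s ∈ Icc a b, HasDerivAt m (m' s) s) (hb : ∀ s ∈ Icc a b, ‖m' s‖ₑ ≤ C) :
    ‖m a - m b‖ₑ ≤ C * ENNReal.ofReal (b - a) := by
  rcases hab.eq_or_lt with rfl | hab'
  · simp
  rcases eq_or_ne C ⊤ with rfl | hC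
  · simp [ENNReal.top_mul, hab']
  lift C to NNReal using hC
  have h := (convex_Icc a b).norm_image_sub_le_of_norm_hasDerivWithin_le (C := C)
    (fun s hs => (hd s hs).hasDerivWithinAt)
    (fun s hs => by exact_mod_cast enorm_le_coe.1 (hb s hs))
    (right_mem_Icc.2 hab) (left_mem_Icc.2 hab)
  rw [norm_sub_rev a b, Real.norm_of_nonneg (sub_nonneg.2 hab)] at h
  rw [← ofReal_norm, ← ENNReal.ofReal_coe_nnreal, ← ENNReal.ofReal_mul C.coe_nonneg]
  exact ENNReal.ofReal_le_ofReal h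

theorem eLpNorm_indicator_enorm {α F : Type*} [MeasurableSpace α] {μ : Measure α}
    [NormedAddCommGroup F] {s : Set α} (hs : MeasurableSet s) (p : ENNReal) (g : α → F) :
    eLpNorm (s.indicator fun y => ‖g y‖ₑ) p μ = eLpNorm g p (μ.restrict s) := by
  rw [eLpNorm_indicator_eq_eLpNorm_restrict hs]
  exact eLpNorm_enorm g

theorem eLpNorm_le_add_tsum_eLpNorm_sub {α F : Type*} [MeasurableSpace α] {μ : Measure α}
    [NormedAddCommGroup F] {q : ENNReal} (hq : 1 ≤ q) {m : ℕ → α → F} {f : α → F}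
    (hm : ∀ n, AEStronglyMeasurable (m n) μ)
    (hf : ∀ᵐ x ∂μ, Tendsto (fun n => m n x) atTop (𝓝 (f x))) :
    eLpNorm f q μ ≤ eLpNorm (m 0) q μ + ∑' k, eLpNorm (m (k + 1) - m k) q μ := by
  have hpartial (n : ℕ) : eLpNorm (m n) q μ ≤
      eLpNorm (m 0) q μ + ∑ k ∈ Finset.range n, eLpNorm (m (k + 1) - m k) q μ := by
    induction n with
    | zero => simp
    | succ n ih =>
      calc eLpNorm (m (n + 1)) q μ = eLpNorm (m n + (m (n + 1) - m n)) q μ := by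
            rw [add_sub_cancel]
        _ ≤ eLpNorm (m n) q μ + eLpNorm (m (n + 1) - m n) q μ :=
            eLpNorm_add_le (hm n) ((hm _).sub (hm n)) hq
        _ ≤ _ := by
            rw [Finset.sum_range_succ, ← add_assoc]
            gcongr
  exact Lp.eLpNorm_le_of_ae_tendsto (Eventually.of_forall fun n =>
    (hpartial n).trans (by gcongr; exact ENNReal.sum_le_tsum _)) hm hf

section ConeAverage

variable {E : Type*} [NormedAddCommGroup E] [InnerProductSpace ℝ E] [FiniteDimensional ℝ E]
  [MeasurableSpace E] [BorelSpace E] {μ : Measure E} {Ω : Set E} {κ f : E → ℝ} {g : E → E}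

/-- The average of `f` over a neighbourhood of `x` inside `Ω` of size `s` and of the shape of the
support of `κ`. -/
noncomputable def scaledAverage (μ : Measure E) (Ω : Set E) (κ f : E → ℝ) (s : ℝ) (x : E) : ℝ :=
  ∫ y in Ω, scaledKernel κ x s y * f y ∂μ

theorem aestronglyMeasurable_scaledAverage [SFinite μ] (hκ : Continuous κ)
    (hf : AEStronglyMeasurable f (μ.restrict Ω)) (s : ℝ) :
    AEStronglyMeasurable (scaledAverage μ Ω κ f s) (μ.restrict Ω) := by
  have hκs : Continuous fun z : E × E => scaledKernel κ z.1 s z.2 := by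
    unfold scaledKernel
    fun_prop
  exact (hκs.aestronglyMeasurable.mul hf.comp_snd).integral_prod_right'

theorem HasWeakGradient.enorm_scaledAverage_half_sub_le (hw : HasWeakGradient μ Ω f g)
    (hΩ : MeasurableSet Ω) (hf : IntegrableOn f Ω μ) (hg : IntegrableOn g Ω μ)
    (hκ : ContDiff ℝ ∞ κ) (hc : HasCompactSupport κ) {M R : ℝ} (hM : ∀ z, |κ z| ≤ M) (hR : 0 ≤ R)
    (hsupp : Function.support κ ⊆ Metric.closedBall 0 R) {x : E} {s : ℝ} (hs : 0 < s)
    (hcone : ∀ t ∈ Ioc 0 s, ∀ w ∈ tsupport κ, x + t • w ∈ Ω) :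
    ‖scaledAverage μ Ω κ f (s / 2) x - scaledAverage μ Ω κ f s x‖ₑ ≤
      ENNReal.ofReal ((2 / s) ^ Module.finrank ℝ E * M * R * s) *
        ∫⁻ y in Metric.closedBall x (R * s), Ω.indicator (fun y => ‖g y‖ₑ) y ∂μ := by
  have hM0 : 0 ≤ M := (abs_nonneg _).trans (hM 0)
  set H := ∫⁻ y in Metric.closedBall x (R * s), Ω.indicator (fun y => ‖g y‖ₑ) y ∂μ
  have hderiv (t : ℝ) (ht : t ∈ Icc (s / 2) s) :
      ‖∫ y in Ω, -divergence (scaledField κ x t) y * f y ∂μ‖ₑ ≤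
        ENNReal.ofReal ((2 / s) ^ Module.finrank ℝ E * M * R) * H := by
    have ht0 : 0 < t := (half_pos hs).trans_le ht.1
    have hsub : tsupport (scaledField κ x t) ⊆ Ω := by
      refine (tsupport_scaledField_subset hc x ht0.ne').trans ?_
      rintro _ ⟨w, hw, rfl⟩
      exact hcone t ⟨ht0, ht.2⟩ w hw
    have hdiv : ∫ y in Ω, -divergence (scaledField κ x t) y * f y ∂μ =
        ∫ y in Ω, inner ℝ (scaledField κ x t y) (g y) ∂μ := by
      simp_rw [neg_mul, mul_comm _ (f _)]
      rw [integral_neg, hw.integral_mul_divergence hf hg (contDiff_scaledField hκ x t)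
        (hasCompactSupport_scaledField hc x ht0.ne') hsub, neg_neg]
    rw [hdiv]
    refine enorm_integral_inner_le_of_norm_le hΩ ?_ fun y =>
      (norm_scaledField_le hM hR hsupp x ht0 y).trans ?_
    · exact (support_scaledField_subset κ x t).trans
        ((support_scaledKernel_subset_closedBall hsupp x ht0).trans
          (Metric.closedBall_subset_closedBall (by gcongr; exact ht.2)))
    · gcongr
      rw [← inv_div]
      gcongr
      exact ht.1
  refine (enorm_sub_le_of_enorm_deriv_le (half_le_self hs.le) (fun t ht =>
    hasDerivAt_integral_scaledKernel hκ hc hf x ((half_pos hs).trans_le ht.1)) hderiv).trans ?_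
  rw [mul_right_comm, ← ENNReal.ofReal_mul (by positivity)]
  gcongr
  linarith

end ConeAverage

theorem one_sub_inv_add_inv_nonneg {p : NNReal} (hp : 1 ≤ p) (q : NNReal) :
    0 ≤ 1 - (p : ℝ)⁻¹ + (q : ℝ)⁻¹ :=
  add_nonneg (sub_nonneg.2 (inv_le_one_of_one_le₀ (by exact_mod_cast hp))) (by positivity)

theorem tsum_ofReal_rpow_half_ne_top {α : ℝ} (hα : 0 < α) :
    ∑' k : ℕ, ENNReal.ofReal (((1 / 2) ^ k) ^ α) ≠ ⊤ := by
  have hlt : (1 / 2 : ℝ) ^ α < 1 := Real.rpow_lt_one (by norm_num) (by norm_num) hα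
  simp_rw [← Real.rpow_natCast_mul (show (0 : ℝ) ≤ 1 / 2 by norm_num), mul_comm _ α,
    Real.rpow_mul_natCast (show (0 : ℝ) ≤ 1 / 2 by norm_num)]
  exact (summable_geometric_of_lt_one (by positivity) hlt).tsum_ofReal_ne_top

section ConeAverage

variable {E : Type*} [NormedAddCommGroup E] [InnerProductSpace ℝ E] [FiniteDimensional ℝ E]
  [MeasurableSpace E] [BorelSpace E] {μ : Measure E} [μ.IsAddHaarMeasure] {Ω A : Set E}
  {κ f : E → ℝ} {g : E → E} {M R : ℝ} {p q : NNReal}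

theorem integral_scaledKernel (κ : E → ℝ) (x : E) {s : ℝ} (hs : 0 < s) :
    ∫ y, scaledKernel κ x s y ∂μ = ∫ z, κ z ∂μ := by
  unfold scaledKernel
  rw [integral_const_mul, integral_sub_right_eq_self (fun y => κ (s⁻¹ • y)),
    Measure.integral_comp_inv_smul, smul_eq_mul, abs_of_pos (by positivity), ← mul_assoc,
    ← mul_pow, inv_mul_cancel₀ hs.ne', one_pow, one_mul]

theorem ae_tendsto_scaledAverage (hint : ∫ z, κ z ∂μ = 1) (hM : ∀ z, |κ z| ≤ M) (hR : 0 < R)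
    (hsupp : Function.support κ ⊆ Metric.closedBall 0 R) (hΩ : MeasurableSet Ω)
    (hf : IntegrableOn f Ω μ) :
    ∀ᵐ x ∂μ.restrict Ω, Tendsto (fun s => scaledAverage μ Ω κ f s x) (𝓝[>] 0) (𝓝 (f x)) := by
  have hf' : Integrable (Ω.indicator f) μ := (integrable_indicator_iff hΩ).2 hf
  have hr : Tendsto (fun s => R * s) (𝓝[>] 0) (𝓝[>] 0) :=
    tendsto_nhdsWithin_iff.2 ⟨by simpa using (tendsto_nhdsWithin_of_tendsto_nhds
      (tendsto_id (x := 𝓝 (0 : ℝ)))).const_mul R, eventually_mem_nhdsWithin.mono fun s hs =>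
        mul_pos hR hs⟩
  filter_upwards [ae_restrict_of_ae ((Besicovitch.vitaliFamily μ).ae_tendsto_average_norm_sub
    hf'.locallyIntegrable), ae_restrict_mem hΩ] with x hx hxΩ
  have hlim : Tendsto (fun s => ∫ y, scaledKernel κ x s y • Ω.indicator f y ∂μ) (𝓝[>] 0)
      (𝓝 (Ω.indicator f x)) := by
    refine tendsto_integral_smul_of_tendsto_average_norm_sub
      (M * μ.real (Metric.closedBall (0 : E) R))
      ((hx.comp (Besicovitch.tendsto_filterAt μ x)).comp hr)
      (Eventually.of_forall fun _ => hf'.integrableOn)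
      (tendsto_const_nhds.congr' ?_) ?_ ?_ <;>
      filter_upwards [self_mem_nhdsWithin] with s hs
    · rw [integral_scaledKernel κ x hs, hint]
    · exact support_scaledKernel_subset_closedBall hsupp x hs
    · intro y
      have hball : μ.real (Metric.closedBall (0 : E) R) ≠ 0 :=
        (ENNReal.toReal_pos (Metric.measure_closedBall_pos _ _ hR).ne'
          measure_closedBall_lt_top.ne).ne'
      have hscale : μ.real (Metric.closedBall x (R * s)) =
          s ^ Module.finrank ℝ E * μ.real (Metric.closedBall (0 : E) R) := by
        rw [measureReal_def, mul_comm, Measure.addHaar_closedBall_mul _ _ (le_of_lt hs) hR.le,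
          ENNReal.toReal_mul, ENNReal.toReal_ofReal (pow_nonneg (le_of_lt hs) _), measureReal_def]
      rw [hscale, mul_div_mul_right _ _ hball, div_eq_inv_mul, ← inv_pow]
      exact abs_scaledKernel_le hM x hs y
  rw [indicator_of_mem hxΩ] at hlim
  refine hlim.congr fun s => ?_
  rw [scaledAverage, ← integral_indicator hΩ]
  simp_rw [smul_eq_mul, ← indicator_mul_right]

theorem eLpNorm_scaledAverage_one_le (hM : ∀ z, |κ z| ≤ M)
    (hsupp : Function.support κ ⊆ Metric.closedBall 0 R) (hΩ : MeasurableSet Ω)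
    (hf : AEStronglyMeasurable f (μ.restrict Ω)) (hp : 1 ≤ p) (hpq : p ≤ q) :
    eLpNorm (scaledAverage μ Ω κ f 1) q μ ≤ ENNReal.ofReal M *
      (μ (Metric.closedBall 0 R) ^ (1 - (p : ℝ)⁻¹ + (q : ℝ)⁻¹) *
        eLpNorm f p (μ.restrict Ω)) := by
  set G : E → ENNReal := Ω.indicator fun y => ‖f y‖ₑ
  have hG : AEMeasurable G μ := (aemeasurable_indicator_iff hΩ).2 hf.enorm
  rw [← eLpNorm_indicator_enorm hΩ]
  have hpt (x : E) : ‖scaledAverage μ Ω κ f 1 x‖ₑ ≤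
      ENNReal.ofReal M * ‖∫⁻ y in Metric.closedBall x R, G y ∂μ‖ₑ := by
    have hswap : scaledAverage μ Ω κ f 1 x = ∫ y in Ω, inner ℝ (scaledKernel κ x 1 y) (f y) ∂μ :=
      integral_congr_ae (ae_of_all _ fun y => mul_comm _ _)
    rw [hswap]
    refine enorm_integral_inner_le_of_norm_le hΩ ?_ fun y => ?_
    · simpa using support_scaledKernel_subset_closedBall hsupp x one_pos
    · simpa using abs_scaledKernel_le hM x one_pos y
  exact (eLpNorm_le_mul_eLpNorm_of_ae_le_mul'' _
    (aemeasurable_lintegral_closedBall hG R).aestronglyMeasurable (ae_of_all _ hpt)).trans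
    (by gcongr; exact eLpNorm_lintegral_closedBall_le hG hp hpq R)

theorem HasWeakGradient.eLpNorm_scaledAverage_half_sub_le (hw : HasWeakGradient μ Ω f g)
    (hΩ : MeasurableSet Ω) (hf : IntegrableOn f Ω μ) (hg : IntegrableOn g Ω μ)
    (hκ : ContDiff ℝ ∞ κ) (hM : ∀ z, |κ z| ≤ M) (hR : 0 ≤ R)
    (hsupp : Function.support κ ⊆ Metric.closedBall 0 R) (hA : MeasurableSet A) {s : ℝ}
    (hs : 0 < s) (hcone : ∀ x ∈ A, ∀ t ∈ Ioc 0 s, ∀ w ∈ tsupport κ, x + t • w ∈ Ω)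
    (hp : 1 ≤ p) (hpq : p ≤ q) :
    eLpNorm (scaledAverage μ Ω κ f (s / 2) - scaledAverage μ Ω κ f s) q (μ.restrict A) ≤
      ENNReal.ofReal (s ^ (1 - Module.finrank ℝ E * ((p : ℝ)⁻¹ - (q : ℝ)⁻¹))) *
        (ENNReal.ofReal (2 ^ Module.finrank ℝ E * M * R) *
          (μ (Metric.closedBall 0 R) ^ (1 - (p : ℝ)⁻¹ + (q : ℝ)⁻¹) *
            eLpNorm g p (μ.restrict Ω))) := by
  have hc : HasCompactSupport κ :=
    HasCompactSupport.intro (isCompact_closedBall 0 R) fun z hz => by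
      simpa using fun h => hz (hsupp h)
  have hM0 : 0 ≤ M := (abs_nonneg _).trans (hM 0)
  have hθ : 0 ≤ 1 - (p : ℝ)⁻¹ + (q : ℝ)⁻¹ := one_sub_inv_add_inv_nonneg hp q
  set d := Module.finrank ℝ E
  set G : E → ENNReal := Ω.indicator fun y => ‖g y‖ₑ
  have hG : AEMeasurable G μ := (aemeasurable_indicator_iff hΩ).2 hg.1.enorm
  have hpow : (2 / s) ^ d * M * R * s * s ^ (d * (1 - (p : ℝ)⁻¹ + (q : ℝ)⁻¹)) =
      s ^ (1 - d * ((p : ℝ)⁻¹ - (q : ℝ)⁻¹)) * (2 ^ d * M * R) := by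
    rw [div_pow, show 1 - d * ((p : ℝ)⁻¹ - (q : ℝ)⁻¹) =
      1 - d + d * (1 - (p : ℝ)⁻¹ + (q : ℝ)⁻¹) by ring, Real.rpow_add hs, Real.rpow_sub hs,
      Real.rpow_one, Real.rpow_natCast]
    ring
  calc eLpNorm (scaledAverage μ Ω κ f (s / 2) - scaledAverage μ Ω κ f s) q (μ.restrict A)
      ≤ ENNReal.ofReal ((2 / s) ^ d * M * R * s) *
          eLpNorm (fun x => ∫⁻ y in Metric.closedBall x (R * s), G y ∂μ) q (μ.restrict A) :=
        eLpNorm_le_mul_eLpNorm_of_ae_le_mul'' _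
          ((aemeasurable_lintegral_closedBall hG _).restrict).aestronglyMeasurable
          ((ae_restrict_mem hA).mono fun x hx =>
            hw.enorm_scaledAverage_half_sub_le hΩ hf hg hκ hc hM hR hsupp hs (hcone x hx))
    _ ≤ ENNReal.ofReal ((2 / s) ^ d * M * R * s) *
          (μ (Metric.closedBall 0 (R * s)) ^ (1 - (p : ℝ)⁻¹ + (q : ℝ)⁻¹) * eLpNorm G p μ) := by
        gcongr
        exact (eLpNorm_restrict_le _ _ _ _).trans (eLpNorm_lintegral_closedBall_le hG hp hpq _)
    _ = _ := by
        rw [eLpNorm_indicator_enorm hΩ, addHaar_closedBall_rpow hR hs.le hθ]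
        simp only [← mul_assoc]
        rw [← ENNReal.ofReal_mul (by positivity), ← ENNReal.ofReal_mul (by positivity), ← hpow]

theorem HasWeakGradient.eLpNorm_le_of_kernel (hw : HasWeakGradient μ Ω f g)
    (hΩ : MeasurableSet Ω) (hf : IntegrableOn f Ω μ) (hg : IntegrableOn g Ω μ)
    (hκ : ContDiff ℝ ∞ κ) (hint : ∫ z, κ z ∂μ = 1) (hM : ∀ z, |κ z| ≤ M) (hR : 0 < R)
    (hsupp : Function.support κ ⊆ Metric.closedBall 0 R) (hA : MeasurableSet A) (hAΩ : A ⊆ Ω)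
    (hcone : ∀ x ∈ A, ∀ t ∈ Ioc (0 : ℝ) 1, ∀ w ∈ tsupport κ, x + t • w ∈ Ω)
    (hp : 1 ≤ p) (hpq : p ≤ q) :
    eLpNorm f q (μ.restrict A) ≤ ENNReal.ofReal M *
        (μ (Metric.closedBall 0 R) ^ (1 - (p : ℝ)⁻¹ + (q : ℝ)⁻¹) *
          eLpNorm f p (μ.restrict Ω)) +
      (∑' k : ℕ, ENNReal.ofReal
        (((1 / 2) ^ k) ^ (1 - Module.finrank ℝ E * ((p : ℝ)⁻¹ - (q : ℝ)⁻¹)))) *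
        (ENNReal.ofReal (2 ^ Module.finrank ℝ E * M * R) *
          (μ (Metric.closedBall 0 R) ^ (1 - (p : ℝ)⁻¹ + (q : ℝ)⁻¹) *
            eLpNorm g p (μ.restrict Ω))) := by
  set m : ℕ → E → ℝ := fun k => scaledAverage μ Ω κ f ((1 / 2) ^ k)
  have hscale : Tendsto (fun k : ℕ => (1 / 2 : ℝ) ^ k) atTop (𝓝[>] 0) :=
    tendsto_nhdsWithin_iff.2 ⟨tendsto_pow_atTop_nhds_zero_of_lt_one (by norm_num) (by norm_num),
      Eventually.of_forall fun k => mem_Ioi.2 (by positivity)⟩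
  have hlim : ∀ᵐ x ∂μ.restrict A, Tendsto (fun k => m k x) atTop (𝓝 (f x)) :=
    (ae_restrict_of_ae_restrict_of_subset hAΩ
      (ae_tendsto_scaledAverage hint hM hR hsupp hΩ hf)).mono fun x hx => hx.comp hscale
  refine (eLpNorm_le_add_tsum_eLpNorm_sub (by exact_mod_cast hp.trans hpq) (fun k =>
    (aestronglyMeasurable_scaledAverage hκ.continuous hf.1 _).mono_measure
      (Measure.restrict_mono hAΩ le_rfl)) hlim).trans (add_le_add ?_ ?_)
  · simpa [m] using (eLpNorm_restrict_le _ _ _ _).trans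
      (eLpNorm_scaledAverage_one_le hM hsupp hΩ hf.1 hp hpq)
  · rw [← ENNReal.tsum_mul_right]
    refine ENNReal.tsum_le_tsum fun k => ?_
    have hk : (1 / 2 : ℝ) ^ (k + 1) = (1 / 2) ^ k / 2 := by ring
    simp only [hk]
    exact hw.eLpNorm_scaledAverage_half_sub_le hΩ hf hg hκ hM hR.le hsupp hA (by positivity)
      (fun x hx t ht => hcone x hx t ⟨ht.1, ht.2.trans (pow_le_one₀ (by norm_num) (by norm_num))⟩)
      hp hpq

/-- From each point of `A` the same cone of height `1` stays inside `Ω`; the cone is spanned by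
a ball that need not avoid the origin, in which case it is a neighbourhood of the vertex. -/
def HasUniformCone (Ω A : Set E) : Prop :=
  ∃ (w₀ : E) (ρ : ℝ), 0 < ρ ∧
    ∀ x ∈ A, ∀ t ∈ Ioc (0 : ℝ) 1, ∀ w ∈ Metric.closedBall w₀ ρ, x + t • w ∈ Ω

theorem exists_eLpNorm_le_of_hasUniformCone (hΩ : MeasurableSet Ω) (hfin : μ Ω ≠ ⊤)
    (hA : MeasurableSet A) (hAΩ : A ⊆ Ω) (hcone : HasUniformCone Ω A)
    (hp : 1 ≤ p) (hpq : p ≤ q) (hα : Module.finrank ℝ E * ((p : ℝ)⁻¹ - (q : ℝ)⁻¹) < 1) :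
    ∃ C : ENNReal, C ≠ ⊤ ∧ ∀ (f : E → ℝ) (g : E → E), MemLp f p (μ.restrict Ω) →
      MemLp g p (μ.restrict Ω) → HasWeakGradient μ Ω f g →
      eLpNorm f q (μ.restrict A) ≤
        C * (eLpNorm f p (μ.restrict Ω) + eLpNorm g p (μ.restrict Ω)) := by
  obtain ⟨w₀, ρ, hρ, hcone⟩ := hcone
  let β : ContDiffBump w₀ := ⟨ρ / 2, ρ, half_pos hρ, half_lt_self hρ⟩
  have hsmooth : ContDiff ℝ ∞ (β.normed μ) := β.contDiff_normed
  have hsupp : tsupport (β.normed μ) = Metric.closedBall w₀ ρ := β.tsupport_normed_eq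
  have hsupp₀ : Function.support (β.normed μ) ⊆ Metric.closedBall 0 (‖w₀‖ + ρ) := by
    refine (subset_tsupport _).trans (hsupp.trans_subset (Metric.closedBall_subset_closedBall' ?_))
    rw [dist_zero_right, add_comm]
  obtain ⟨M, hM⟩ :=
    β.hasCompactSupport_normed.exists_bound_of_continuous hsmooth.continuous
  have : IsFiniteMeasure (μ.restrict Ω) := isFiniteMeasure_restrict.2 hfin
  have hp' : (1 : ENNReal) ≤ p := by exact_mod_cast hp
  have hθ : 0 ≤ 1 - (p : ℝ)⁻¹ + (q : ℝ)⁻¹ := one_sub_inv_add_inv_nonneg hp q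
  set B := μ (Metric.closedBall 0 (‖w₀‖ + ρ)) ^ (1 - (p : ℝ)⁻¹ + (q : ℝ)⁻¹)
  have hB : B ≠ ⊤ := ENNReal.rpow_ne_top_of_nonneg hθ measure_closedBall_lt_top.ne
  set N := ∑' k : ℕ, ENNReal.ofReal
    (((1 / 2) ^ k) ^ (1 - Module.finrank ℝ E * ((p : ℝ)⁻¹ - (q : ℝ)⁻¹)))
  have hN : N ≠ ⊤ := tsum_ofReal_rpow_half_ne_top (sub_pos.2 hα)
  set K := ENNReal.ofReal (2 ^ Module.finrank ℝ E * M * (‖w₀‖ + ρ))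
  refine ⟨ENNReal.ofReal M * B + N * (K * B), ?_, fun f g hf hg hw => ?_⟩
  · finiteness
  calc eLpNorm f q (μ.restrict A)
      ≤ ENNReal.ofReal M * (B * eLpNorm f p (μ.restrict Ω)) +
          N * (K * (B * eLpNorm g p (μ.restrict Ω))) :=
        hw.eLpNorm_le_of_kernel hΩ (hf.integrable hp') (hg.integrable hp') hsmooth
          β.integral_normed hM (by positivity) hsupp₀ hA hAΩ
          (fun x hx t ht w hw => hcone x hx t ht w (hsupp ▸ hw)) hp hpq
    _ = ENNReal.ofReal M * B * eLpNorm f p (μ.restrict Ω) +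
          N * (K * B) * eLpNorm g p (μ.restrict Ω) := by ring
    _ ≤ _ := by
        rw [mul_add]
        gcongr
        · exact le_self_add
        · exact le_add_self

end ConeAverage

theorem eLpNorm_restrict_biUnion_le {α ι F : Type*} [MeasurableSpace α] {μ : Measure α}
    [NormedAddCommGroup F] {q : NNReal} (hq : 1 ≤ q) (s : Finset ι) (A : ι → Set α) (f : α → F) :
    eLpNorm f q (μ.restrict (⋃ i ∈ s, A i)) ≤ ∑ i ∈ s, eLpNorm f q (μ.restrict (A i)) := by
  classical
  have hq1 : 1 ≤ (q : ℝ) := by exact_mod_cast hq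
  have hq0 : q ≠ 0 := (zero_lt_one.trans_le hq).ne'
  induction s using Finset.induction_on with
  | empty => simp
  | insert i s hi ih =>
    rw [Finset.set_biUnion_insert, Finset.sum_insert hi]
    refine (eLpNorm_mono_measure f (Measure.restrict_union_le _ _)).trans
      (le_trans ?_ (add_le_add le_rfl ih))
    simp only [eLpNorm_nnreal_eq_lintegral hq0, lintegral_add_measure]
    exact ENNReal.rpow_add_le_add_rpow _ _ (by positivity)
      ((div_le_one (by positivity)).2 hq1)

theorem exists_eLpNorm_le_of_locally_hasUniformCone {E : Type*} [NormedAddCommGroup E]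
    [InnerProductSpace ℝ E] [FiniteDimensional ℝ E] [MeasurableSpace E] [BorelSpace E]
    {μ : Measure E} [μ.IsAddHaarMeasure] {Ω : Set E} (hΩ : IsOpen Ω)
    (hb : Bornology.IsBounded Ω)
    (hcone : ∀ x ∈ closure Ω, ∃ U : Set E, IsOpen U ∧ x ∈ U ∧ HasUniformCone Ω (U ∩ Ω))
    {p q : NNReal} (hp : 1 ≤ p) (hpq : p ≤ q)
    (hα : Module.finrank ℝ E * ((p : ℝ)⁻¹ - (q : ℝ)⁻¹) < 1) :
    ∃ C : ENNReal, C ≠ ⊤ ∧ ∀ (f : E → ℝ) (g : E → E), MemLp f p (μ.restrict Ω) →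
      MemLp g p (μ.restrict Ω) → HasWeakGradient μ Ω f g →
      eLpNorm f q (μ.restrict Ω) ≤
        C * (eLpNorm f p (μ.restrict Ω) + eLpNorm g p (μ.restrict Ω)) := by
  choose! U hUo hxU hUcone using hcone
  obtain ⟨t, ht⟩ := hb.isCompact_closure.elim_nhds_subcover' (fun x _ => U x)
    fun x hx => (hUo x hx).mem_nhds (hxU x hx)
  choose C hCtop hC using fun x : closure Ω =>
    exists_eLpNorm_le_of_hasUniformCone (μ := μ) hΩ.measurableSet hb.measure_lt_top.ne
      ((hUo x x.2).inter hΩ).measurableSet inter_subset_right (hUcone x x.2) hp hpq hα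
  refine ⟨∑ x ∈ t, C x, ENNReal.sum_ne_top.2 fun x _ => hCtop x, fun f g hf hg hw => ?_⟩
  have hcover : Ω ⊆ ⋃ x ∈ t, (U x ∩ Ω) := fun y hy => by
    obtain ⟨x, hxt, hyx⟩ := mem_iUnion₂.1 (ht (subset_closure hy))
    exact mem_iUnion₂.2 ⟨x, hxt, hyx, hy⟩
  calc eLpNorm f q (μ.restrict Ω)
      ≤ eLpNorm f q (μ.restrict (⋃ x ∈ t, (U x ∩ Ω))) :=
        eLpNorm_mono_measure f (Measure.restrict_mono hcover le_rfl)
    _ ≤ ∑ x ∈ t, eLpNorm f q (μ.restrict (U x ∩ Ω)) :=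
        eLpNorm_restrict_biUnion_le (hp.trans hpq) t _ f
    _ ≤ _ := by
        rw [Finset.sum_mul]
        exact Finset.sum_le_sum fun x _ => hC x f g hf hg hw

/-! ### The Sobolev embedding in Lipschitz domains -/

theorem add_smul_mem_ball {E : Type*} [NormedAddCommGroup E] [NormedSpace ℝ E] {x₀ x w : E}
    {r t : ℝ} (hx : x ∈ Metric.ball x₀ (r / 2)) (ht : t ∈ Ioc (0 : ℝ) 1) (hw : ‖w‖ ≤ r / 2) :
    x + t • w ∈ Metric.ball x₀ r := by
  have htw : ‖t • w‖ ≤ r / 2 := by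
    rw [norm_smul, Real.norm_of_nonneg ht.1.le]
    exact (mul_le_of_le_one_left (norm_nonneg w) ht.2).trans hw
  rw [mem_ball_iff_norm] at hx ⊢
  calc ‖x + t • w - x₀‖ = ‖(x - x₀) + t • w‖ := by rw [add_sub_right_comm]
    _ ≤ ‖x - x₀‖ + ‖t • w‖ := norm_add_le _ _
    _ < r := by linarith

theorem exists_hasUniformCone_of_mem {E : Type*} [NormedAddCommGroup E] [InnerProductSpace ℝ E]
    {Ω : Set E} (hΩ : IsOpen Ω) {x₀ : E} (hx₀ : x₀ ∈ Ω) :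
    ∃ U : Set E, IsOpen U ∧ x₀ ∈ U ∧ HasUniformCone Ω (U ∩ Ω) := by
  obtain ⟨r, hr, hball⟩ := Metric.isOpen_iff.1 hΩ x₀ hx₀
  exact ⟨Metric.ball x₀ (r / 2), Metric.isOpen_ball, Metric.mem_ball_self (half_pos hr), 0, r / 2,
    half_pos hr, fun x hx t ht w hw =>
      hball (add_smul_mem_ball hx.1 ht (mem_closedBall_zero_iff.1 hw))⟩

theorem lipschitz_lt_apply_two_add_smul {ψ : EuclideanSpace ℝ (Fin 2) → ℝ} {K : NNReal}
    (hψ : LipschitzWith K ψ) {y v : Vec} (hy : ψ !₂[y 0, y 1] < y 2)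
    (hv : K * ‖!₂[v 0, v 1]‖ ≤ v 2) {t : ℝ} (ht : 0 ≤ t) :
    ψ !₂[(y + t • v) 0, (y + t • v) 1] < (y + t • v) 2 := by
  have hdiff : !₂[(y + t • v) 0, (y + t • v) 1] - !₂[y 0, y 1] = t • !₂[v 0, v 1] := by
    ext i
    fin_cases i <;> simp
  calc ψ !₂[(y + t • v) 0, (y + t • v) 1]
      ≤ ψ !₂[y 0, y 1] + K * ‖t • !₂[v 0, v 1]‖ := by
        rw [← hdiff, ← sub_le_iff_le_add']
        exact (le_abs_self _).trans (hψ.norm_sub_le _ _)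
    _ = ψ !₂[y 0, y 1] + t * (K * ‖!₂[v 0, v 1]‖) := by
        rw [norm_smul, Real.norm_of_nonneg ht]
        ring
    _ < y 2 + t * v 2 := add_lt_add_of_lt_of_le hy (mul_le_mul_of_nonneg_left hv ht)
    _ = (y + t • v) 2 := by simp

theorem norm_toLp_pair_le (z : Vec) : ‖!₂[z 0, z 1]‖ ≤ ‖z‖ := by
  rw [EuclideanSpace.norm_eq, EuclideanSpace.norm_eq, Fin.sum_univ_two, Fin.sum_univ_three]
  exact Real.sqrt_le_sqrt (le_add_of_nonneg_right (by positivity))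

theorem IsBoundedLipschitzDomain.exists_hasUniformCone_of_mem_frontier {Ω : Set Vec}
    (hΩ : IsBoundedLipschitzDomain Ω) {x₀ : Vec} (hx₀ : x₀ ∈ frontier Ω) :
    ∃ U : Set Vec, IsOpen U ∧ x₀ ∈ U ∧ HasUniformCone Ω (U ∩ Ω) := by
  obtain ⟨e, ψ, K, U, hψ, hU, hxU, hgraph⟩ := hΩ.exists_chart x₀ hx₀
  obtain ⟨r, hr, hball⟩ := Metric.isOpen_iff.1 hU x₀ hxU
  -- The cone points upwards in the chart, with axis of length `r / 4` and slope at least `K`.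
  let ρ : ℝ := r / 4 / (K + 1)
  have hρ : 0 < ρ := by positivity
  have hKρ : K * ρ + ρ = r / 4 := by simp only [ρ]; field_simp
  have hρr : ρ ≤ r / 4 := by linarith [mul_nonneg K.coe_nonneg hρ.le]
  refine ⟨Metric.ball x₀ (r / 2), Metric.isOpen_ball, Metric.mem_ball_self (half_pos hr),
    e.symm (EuclideanSpace.single 2 (r / 4)), ρ, hρ, fun x hx t ht w hw => ?_⟩
  obtain ⟨z, rfl⟩ : ∃ z, w = e.symm (EuclideanSpace.single 2 (r / 4) + z) :=
    ⟨e w - EuclideanSpace.single 2 (r / 4), by simp⟩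
  have hz : ‖z‖ ≤ ρ := by
    rwa [map_add, mem_closedBall_iff_norm, add_sub_cancel_left, e.symm.norm_map] at hw
  have hnorm : ‖e.symm (EuclideanSpace.single 2 (r / 4) + z)‖ ≤ r / 2 := by
    rw [e.symm.norm_map]
    refine (norm_add_le _ _).trans ?_
    rw [PiLp.norm_single, Real.norm_of_nonneg (by positivity)]
    linarith
  have hxU' : x ∈ U := hball (Metric.ball_subset_ball (half_le_self hr.le) hx.1)
  rw [hgraph _ (hball (add_smul_mem_ball hx.1 ht hnorm)), map_add, map_smul, e.apply_symm_apply]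
  refine lipschitz_lt_apply_two_add_smul hψ ((hgraph x hxU').1 hx.2) ?_ ht.1.le
  have hz₂ : -ρ ≤ z 2 := neg_le_of_abs_le ((PiLp.norm_apply_le z 2).trans hz)
  calc K * ‖!₂[(EuclideanSpace.single 2 (r / 4) + z : Vec) 0,
        (EuclideanSpace.single 2 (r / 4) + z : Vec) 1]‖
      ≤ K * ρ := by
        gcongr
        simpa using (norm_toLp_pair_le z).trans hz
    _ ≤ r / 4 + z 2 := by linarith
    _ = (EuclideanSpace.single 2 (r / 4) + z : Vec) 2 := by simp

theorem IsBoundedLipschitzDomain.exists_hasUniformCone {Ω : Set Vec}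
    (hΩ : IsBoundedLipschitzDomain Ω) {x₀ : Vec} (hx₀ : x₀ ∈ closure Ω) :
    ∃ U : Set Vec, IsOpen U ∧ x₀ ∈ U ∧ HasUniformCone Ω (U ∩ Ω) := by
  by_cases hx : x₀ ∈ Ω
  · exact exists_hasUniformCone_of_mem hΩ.isOpen hx
  · exact hΩ.exists_hasUniformCone_of_mem_frontier ⟨hx₀, fun h => hx (interior_subset h)⟩

/-- The gradient of the `i`-th component, read off the full gradient. -/
noncomputable def gradRow {ι : Type} [Fintype ι] (i : ι) (a : EuclideanSpace ℝ (ι × Fin 3)) :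
    Vec :=
  WithLp.toLp 2 fun j => a (i, j)

theorem continuous_gradRow {ι : Type} [Fintype ι] (i : ι) : Continuous (gradRow i) := by
  unfold gradRow
  fun_prop

theorem norm_gradRow_le {ι : Type} [Fintype ι] (i : ι) (a : EuclideanSpace ℝ (ι × Fin 3)) :
    ‖gradRow i a‖ ≤ ‖a‖ := by
  rw [EuclideanSpace.norm_eq, EuclideanSpace.norm_eq, Fintype.sum_prod_type]
  exact Real.sqrt_le_sqrt (Finset.single_le_sum (f := fun i => ∑ j, ‖a (i, j)‖ ^ 2)
    (fun i _ => Finset.sum_nonneg fun j _ => by positivity) (Finset.mem_univ i))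

theorem memLp_apply {α ι : Type*} [MeasurableSpace α] [Fintype ι] {μ : Measure α}
    {p : ENNReal} {u : α → EuclideanSpace ℝ ι} (hu : MemLp u p μ) (i : ι) :
    MemLp (fun x => u x i) p μ :=
  (EuclideanSpace.proj i : EuclideanSpace ℝ ι →L[ℝ] ℝ).comp_memLp' hu

theorem memLp_gradRow {Ω : Set Vec} {ι : Type} [Fintype ι] (G : L2 Ω (ι × Fin 3)) (i : ι) :
    MemLp (fun x => gradRow i (G x)) 2 (volume.restrict Ω) :=
  (Lp.memLp G).of_le ((continuous_gradRow i).comp_aestronglyMeasurable (Lp.aestronglyMeasurable G))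
    (ae_of_all _ fun x => norm_gradRow_le i (G x))

theorem IsWeakGrad.hasWeakGradient {Ω : Set Vec} {ι : Type} [Fintype ι] {u : L2 Ω ι}
    {G : L2 Ω (ι × Fin 3)} (h : IsWeakGrad u G) (i : ι) :
    HasWeakGradient volume Ω (fun x => u x i) fun x => gradRow i (G x) := by
  intro φ hφ hc hsub v
  have hφ₂ : MemLp φ 2 (volume.restrict Ω) := hφ.continuous.memLp_of_hasCompactSupport hc
  have hdφ₂ (j) : MemLp (fun x => fderiv ℝ φ x (EuclideanSpace.single j 1)) 2
      (volume.restrict Ω) :=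
    ((hφ.continuous_fderiv (by simp)).clm_apply continuous_const).memLp_of_hasCompactSupport
      (hc.fderiv_apply (𝕜 := ℝ) _)
  have hint₁ (j) : Integrable (fun x => u x i * fderiv ℝ φ x (EuclideanSpace.single j 1))
      (volume.restrict Ω) := (memLp_apply (Lp.memLp u) i).integrable_mul (hdφ₂ j)
  have hint₂ (j) : Integrable (fun x => G x (i, j) * φ x) (volume.restrict Ω) :=
    (memLp_apply (Lp.memLp G) (i, j)).integrable_mul hφ₂
  have hv (x : Vec) : fderiv ℝ φ x v = ∑ j, v j * fderiv ℝ φ x (EuclideanSpace.single j 1) := by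
    conv_lhs => rw [← (EuclideanSpace.basisFun (Fin 3) ℝ).sum_repr v]
    simp
  have hleft (x : Vec) : u x i * fderiv ℝ φ x v =
      ∑ j, v j * (u x i * fderiv ℝ φ x (EuclideanSpace.single j 1)) := by
    rw [hv, Finset.mul_sum]
    exact Finset.sum_congr rfl fun j _ => by ring
  have hright (x : Vec) : inner ℝ v (gradRow i (G x)) * φ x =
      ∑ j, v j * (G x (i, j) * φ x) := by
    rw [PiLp.inner_apply, Finset.sum_mul]
    exact Finset.sum_congr rfl fun j _ => by simp [gradRow]; ring
  simp_rw [hleft, hright]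
  rw [integral_finsetSum _ fun j _ => (hint₁ j).const_mul (v j),
    integral_finsetSum _ fun j _ => (hint₂ j).const_mul (v j), ← Finset.sum_neg_distrib]
  exact Finset.sum_congr rfl fun j _ => by
    rw [integral_const_mul, integral_const_mul, h φ hφ hc hsub, mul_neg]

theorem norm_le_sum_norm_apply {ι : Type*} [Fintype ι] (a : EuclideanSpace ℝ ι) :
    ‖a‖ ≤ ∑ i, ‖a i‖ := by
  rw [EuclideanSpace.norm_eq]
  exact Real.sqrt_le_iff.2 ⟨by positivity,
    Finset.sum_sq_le_sq_sum_of_nonneg fun i _ => norm_nonneg _⟩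

theorem eLpNorm_le_sum_eLpNorm_apply {α ι : Type*} [MeasurableSpace α] [Fintype ι]
    {μ : Measure α} {u : α → EuclideanSpace ℝ ι} (hu : AEStronglyMeasurable u μ) {p : ENNReal}
    (hp : 1 ≤ p) : eLpNorm u p μ ≤ ∑ i, eLpNorm (fun x => u x i) p μ := by
  have hui (i : ι) : AEStronglyMeasurable (fun x => u x i) μ :=
    (EuclideanSpace.proj i : EuclideanSpace ℝ ι →L[ℝ] ℝ).continuous.comp_aestronglyMeasurable hu
  calc eLpNorm u p μ ≤ eLpNorm (∑ i, fun x => ‖u x i‖) p μ :=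
        eLpNorm_mono_real fun x => by simpa using norm_le_sum_norm_apply (u x)
    _ ≤ ∑ i, eLpNorm (fun x => ‖u x i‖) p μ := eLpNorm_sum_le (fun i _ => (hui i).norm) hp
    _ = ∑ i, eLpNorm (fun x => u x i) p μ := by simp only [eLpNorm_norm]

theorem IsBoundedLipschitzDomain.exists_eLpNorm_le {Ω : Set Vec}
    (hΩ : IsBoundedLipschitzDomain Ω) (ι : Type) [Fintype ι] {q : NNReal} (hq : 2 ≤ q)
    (hq' : q < 6) :
    ∃ C : ENNReal, C ≠ ⊤ ∧ ∀ (u : L2 Ω ι) (G : L2 Ω (ι × Fin 3)), IsWeakGrad u G →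
      eLpNorm u q (volume.restrict Ω) ≤ C * (‖u‖ₑ + ‖G‖ₑ) := by
  have hexp : Module.finrank ℝ Vec * (((2 : NNReal) : ℝ)⁻¹ - (q : ℝ)⁻¹) < 1 := by
    have hq₀ : (0 : ℝ) < q := by exact_mod_cast two_pos.trans_le hq
    have hq₆ : (6 : ℝ)⁻¹ < (q : ℝ)⁻¹ := inv_strictAnti₀ hq₀ (by exact_mod_cast hq')
    rw [finrank_euclideanSpace_fin]
    norm_num at hq₆ ⊢
    linarith
  obtain ⟨C, hC, h⟩ := exists_eLpNorm_le_of_locally_hasUniformCone (μ := volume) hΩ.isOpen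
    hΩ.isBounded (fun x hx => hΩ.exists_hasUniformCone hx) one_le_two hq hexp
  have hq₁ : (1 : ENNReal) ≤ q := by exact_mod_cast one_le_two.trans hq
  refine ⟨Fintype.card ι * C, by finiteness, fun u G hG => ?_⟩
  calc eLpNorm u q (volume.restrict Ω)
      ≤ ∑ i, eLpNorm (fun x => u x i) q (volume.restrict Ω) :=
        eLpNorm_le_sum_eLpNorm_apply (Lp.aestronglyMeasurable u) hq₁
    _ ≤ ∑ _i : ι, C * (‖u‖ₑ + ‖G‖ₑ) := by
        gcongr with i
        refine (h _ _ (memLp_apply (Lp.memLp u) i) (memLp_gradRow G i)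
          (hG.hasWeakGradient i)).trans ?_
        rw [Lp.enorm_def, Lp.enorm_def]
        gcongr
        · exact eLpNorm_mono fun x => PiLp.norm_apply_le (u x) i
        · exact eLpNorm_mono fun x => norm_gradRow_le i (G x)
    _ = Fintype.card ι * C * (‖u‖ₑ + ‖G‖ₑ) := by simp [mul_assoc]

/-! ### Weak gradients -/

section WeakGrad

variable {Ω : Set Vec} {ι : Type} [Fintype ι]

theorem isWeakGrad_weakGrad {u : L2 Ω ι} (hu : MemH1 u) : IsWeakGrad u (weakGrad u) := by
  rw [weakGrad, dif_pos hu]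
  exact hu.choose_spec

theorem integral_smul_apply_mul (c : ℝ) (f : L2 Ω ι) (i : ι) (ψ : Vec → ℝ) :
    ∫ x in Ω, (c • f : L2 Ω ι) x i * ψ x = c * ∫ x in Ω, f x i * ψ x := by
  rw [← integral_const_mul]
  refine integral_congr_ae ?_
  filter_upwards [Lp.coeFn_smul c f] with x hx
  rw [hx, Pi.smul_apply, PiLp.smul_apply, smul_eq_mul, mul_assoc]

theorem IsWeakGrad.smul {u : L2 Ω ι} {G : L2 Ω (ι × Fin 3)} (h : IsWeakGrad u G) (c : ℝ) :
    IsWeakGrad (c • u) (c • G) := fun φ hφ hc hsub i j => by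
  rw [integral_smul_apply_mul, integral_smul_apply_mul, h φ hφ hc hsub i j, mul_neg]

theorem isWeakGrad_zero : IsWeakGrad (0 : L2 Ω ι) 0 := fun φ _ _ _ i j => by
  rw [← zero_smul ℝ (0 : L2 Ω ι), ← zero_smul ℝ (0 : L2 Ω (ι × Fin 3)), integral_smul_apply_mul,
    integral_smul_apply_mul, zero_mul, zero_mul, neg_zero]

theorem IsWeakGrad.unique (hΩ : IsOpen Ω) {u : L2 Ω ι} {G G' : L2 Ω (ι × Fin 3)}
    (h : IsWeakGrad u G) (h' : IsWeakGrad u G') : G = G' := by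
  have hloc (F : L2 Ω (ι × Fin 3)) (p : ι × Fin 3) :
      LocallyIntegrable (fun x => F x p) (volume.restrict Ω) :=
    (memLp_apply (Lp.memLp F) p).locallyIntegrable one_le_two
  have hzero (p : ι × Fin 3) : ∀ᵐ x ∂(volume.restrict Ω), x ∈ Ω → G x p - G' x p = 0 := by
    refine hΩ.ae_eq_zero_of_integral_contDiff_smul_eq_zero
      (((hloc G p).sub (hloc G' p)).locallyIntegrableOn _) fun φ hφ hc hsub => ?_
    have hint (F : L2 Ω (ι × Fin 3)) : Integrable (fun x => φ x * F x p) (volume.restrict Ω) :=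
      (hloc F p).integrable_smul_left_of_hasCompactSupport hφ.continuous hc
    have hsame : ∫ x in Ω, φ x * G x p = ∫ x in Ω, φ x * G' x p := by
      simp_rw [mul_comm (φ _)]
      exact neg_injective ((h φ hφ hc hsub p.1 p.2).symm.trans (h' φ hφ hc hsub p.1 p.2))
    simp_rw [smul_eq_mul, mul_sub]
    rw [integral_sub (hint G) (hint G'), hsame, sub_self]
  ext1
  filter_upwards [ae_all_iff.2 hzero, ae_restrict_mem hΩ.measurableSet] with x hx hxΩ
  ext p
  exact sub_eq_zero.1 (hx p hxΩ)

theorem MemH1.smul {u : L2 Ω ι} (hu : MemH1 u) (c : ℝ) : MemH1 (c • u) :=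
  ⟨_, (isWeakGrad_weakGrad hu).smul c⟩

theorem weakGrad_smul (hΩ : IsOpen Ω) {u : L2 Ω ι} (hu : MemH1 u) (c : ℝ) :
    weakGrad (c • u) = c • weakGrad u :=
  (isWeakGrad_weakGrad (hu.smul c)).unique hΩ ((isWeakGrad_weakGrad hu).smul c)

theorem MemH1.memLp (hΩ : IsBoundedLipschitzDomain Ω) {u : L2 Ω ι} (hu : MemH1 u)
    {q : NNReal} (hq : 2 ≤ q) (hq' : q < 6) : MemLp u q (volume.restrict Ω) := by
  obtain ⟨C, hC, hsob⟩ := hΩ.exists_eLpNorm_le ι hq hq'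
  exact ⟨Lp.aestronglyMeasurable u,
    (hsob _ _ (isWeakGrad_weakGrad hu)).trans_lt (by finiteness)⟩

end WeakGrad

/-! ### Trilinear terms -/

section Trilinear

variable {α : Type*} [MeasurableSpace α] {μ : Measure α}
  {E F H : Type*} [NormedAddCommGroup E] [NormedSpace ℝ E] [NormedAddCommGroup F] [NormedSpace ℝ F]
  [NormedAddCommGroup H] [InnerProductSpace ℝ H]

theorem eLpNorm_inner_bilin_le (B : E →L[ℝ] F →L[ℝ] H) {p q r s : ENNReal}
    [ENNReal.HolderTriple p q r] [ENNReal.HolderTriple r s 1] {v : α → E} {G : α → F} {a : α → H}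
    (hv : AEStronglyMeasurable v μ) (hG : AEStronglyMeasurable G μ)
    (ha : AEStronglyMeasurable a μ) :
    eLpNorm (fun x => (inner ℝ (B (v x) (G x)) (a x) : ℝ)) 1 μ ≤
      ‖B‖ₑ * eLpNorm v p μ * eLpNorm G q μ * eLpNorm a s μ := by
  calc eLpNorm (fun x => (inner ℝ (B (v x) (G x)) (a x) : ℝ)) 1 μ
      ≤ (1 : NNReal) * eLpNorm (fun x => B (v x) (G x)) r μ * eLpNorm a s μ :=
        eLpNorm_le_eLpNorm_mul_eLpNorm_of_nnnorm (B.aestronglyMeasurable_comp₂ hv hG) ha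
          (fun b c => inner ℝ b c) 1 (Eventually.of_forall fun x => by
            simpa using nnnorm_inner_le_nnnorm (𝕜 := ℝ) (B (v x) (G x)) (a x))
    _ ≤ ‖B‖ₑ * eLpNorm v p μ * eLpNorm G q μ * eLpNorm a s μ := by
        rw [ENNReal.coe_one, one_mul]
        gcongr
        exact eLpNorm_le_eLpNorm_mul_eLpNorm_of_nnnorm hv hG (fun b c => B b c) ‖B‖₊
          (Eventually.of_forall fun x => B.le_opNorm₂ _ _)

theorem aestronglyMeasurable_integral_inner_bilin_of_memLp_top (B : E →L[ℝ] F →L[ℝ] H)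
    {τ : Type*} [MeasurableSpace τ] {ν : Measure τ} {v : τ → Lp E 2 μ} {G : τ → Lp F 2 μ}
    (hv : AEStronglyMeasurable v ν) (hG : AEStronglyMeasurable G ν) {a : α → H}
    (ha : MemLp a ⊤ μ) :
    AEStronglyMeasurable (fun t => ∫ x, (inner ℝ (B (v t x) (G t x)) (a x) : ℝ) ∂μ) ν := by
  have hpair : AEStronglyMeasurable (fun t => (innerSL ℝ : H →L[ℝ] H →L[ℝ] ℝ).lpPairing μ 1 ⊤
      (B.holderL μ 2 2 1 (v t) (G t)) (ha.toLp a)) ν :=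
    (((innerSL ℝ : H →L[ℝ] H →L[ℝ] ℝ).lpPairing μ 1 ⊤).flip
      (ha.toLp a)).continuous.comp_aestronglyMeasurable
        ((B.holderL μ 2 2 1).aestronglyMeasurable_comp₂ hv hG)
  refine hpair.congr (Eventually.of_forall fun t => ?_)
  simp only [ContinuousLinearMap.lpPairing_eq_integral]
  refine integral_congr_ae ?_
  filter_upwards [B.coeFn_holder (r := 1) (v t) (G t), ha.coeFn_toLp] with x hB ha
  rw [ContinuousLinearMap.holderL_apply_apply, hB, ha]
  rfl

theorem aestronglyMeasurable_integral_inner_bilin (B : E →L[ℝ] F →L[ℝ] H)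
    {τ : Type*} [MeasurableSpace τ] {ν : Measure τ} {v : τ → Lp E 2 μ} {G : τ → Lp F 2 μ}
    (hv : AEStronglyMeasurable v ν) (hG : AEStronglyMeasurable G ν) {a : α → H}
    (ha : StronglyMeasurable a)
    (hint : ∀ᵐ t ∂ν, Integrable (fun x => (inner ℝ (B (v t x) (G t x)) (a x) : ℝ)) μ) :
    AEStronglyMeasurable (fun t => ∫ x, (inner ℝ (B (v t x) (G t x)) (a x) : ℝ) ∂μ) ν := by
  let s (n : ℕ) : Set α := {x | ‖a x‖ ≤ n}
  have hs (n : ℕ) : MeasurableSet (s n) := ha.norm.measurable measurableSet_Iic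
  have hsmono : Monotone s := fun m n hmn x (hx : ‖a x‖ ≤ m) =>
    show ‖a x‖ ≤ n from hx.trans (Nat.cast_le.2 hmn)
  have hsUnion : ⋃ n, s n = univ := iUnion_eq_univ_iff.2 fun x => exists_nat_ge ‖a x‖
  have hbdd (n : ℕ) : MemLp ((s n).indicator a) ⊤ μ := by
    refine memLp_top_of_bound (ha.indicator (hs n)).aestronglyMeasurable n
      (Eventually.of_forall fun x => ?_)
    by_cases hx : x ∈ s n
    · rw [indicator_of_mem hx]
      exact hx
    · simp [indicator_of_notMem hx]
  refine aestronglyMeasurable_of_tendsto_ae atTop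
    (f := fun n t => ∫ x in s n, inner ℝ (B (v t x) (G t x)) (a x) ∂μ) (fun n => ?_) ?_
  · refine (aestronglyMeasurable_integral_inner_bilin_of_memLp_top B hv hG (hbdd n)).congr
      (Eventually.of_forall fun t => ?_)
    simp only [← integral_indicator (hs n)]
    congr 1 with x
    by_cases hx : x ∈ s n <;> simp [hx]
  · filter_upwards [hint] with t ht
    rw [← setIntegral_univ, ← hsUnion]
    exact tendsto_setIntegral_of_monotone hs hsmono ht.integrableOn

end Trilinear


theorem IsBoundedLipschitzDomain.exists_eLpNorm_inner_bilin_le {Ω : Set Vec}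
    (hΩ : IsBoundedLipschitzDomain Ω) {ι κ : Type} [Fintype ι] [Fintype κ] {H : Type*}
    [NormedAddCommGroup H] [InnerProductSpace ℝ H]
    (B : EuclideanSpace ℝ ι →L[ℝ] EuclideanSpace ℝ κ →L[ℝ] H) {a : Vec → H}
    (ha : MemLp a 4 (volume.restrict Ω)) :
    ∃ K : NNReal, ∀ (u : L2 Ω ι) (G : L2 Ω κ), MemH1 u →
      eLpNorm (fun x => (inner ℝ (B (u x) (G x)) (a x) : ℝ)) 1 (volume.restrict Ω) ≤
        K * (‖u‖ₑ + ‖weakGrad u‖ₑ) * ‖G‖ₑ := by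
  obtain ⟨C, hC, hsob⟩ := hΩ.exists_eLpNorm_le ι (q := 4) (by norm_num) (by norm_num)
  have : ENNReal.HolderTriple 4 2 (4⁻¹ + 2⁻¹)⁻¹ := ⟨by rw [inv_inv]⟩
  have : ENNReal.HolderTriple (4⁻¹ + 2⁻¹)⁻¹ 4 1 := ⟨by
    rw [inv_inv, ← ENNReal.toReal_eq_toReal_iff' (by finiteness) (by finiteness)]
    simp [ENNReal.toReal_add]
    norm_num⟩
  have ha_top := ha.eLpNorm_ne_top
  lift ‖B‖ₑ * C * eLpNorm a 4 (volume.restrict Ω) to NNReal using by finiteness with K hK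
  refine ⟨K, fun u G hu => ?_⟩
  calc eLpNorm (fun x => (inner ℝ (B (u x) (G x)) (a x) : ℝ)) 1 (volume.restrict Ω)
      ≤ ‖B‖ₑ * eLpNorm u 4 (volume.restrict Ω) * eLpNorm G 2 (volume.restrict Ω) *
          eLpNorm a 4 (volume.restrict Ω) :=
        eLpNorm_inner_bilin_le B (r := (4⁻¹ + 2⁻¹)⁻¹) (Lp.aestronglyMeasurable u)
          (Lp.aestronglyMeasurable G) ha.1
    _ ≤ ‖B‖ₑ * (C * (‖u‖ₑ + ‖weakGrad u‖ₑ)) * ‖G‖ₑ * eLpNorm a 4 (volume.restrict Ω) := by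
        rw [← Lp.enorm_def]
        gcongr
        exact hsob u _ (isWeakGrad_weakGrad hu)
    _ = K * (‖u‖ₑ + ‖weakGrad u‖ₑ) * ‖G‖ₑ := by rw [hK]; ring

/-- `u ∈ L²(0, T'; H¹(Ω))`, including the square integrability of `u` that `MemL2H1` leaves out. -/
structure InL2H1 {Ω : Set Vec} {ι : Type} [Fintype ι] (T' : ℝ) (u : ℝ → L2 Ω ι) : Prop where
  memLp : MemLp u 2 (volume.restrict (Ioo 0 T'))
  memL2H1 : MemL2H1 T' u

theorem MemLH.inL2H1 {Ω : Set Vec} {T' : ℝ} {V : ℝ → L2 Ω (Fin 3)} (hV : MemLH T' V) :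
    InL2H1 T' V :=
  ⟨hV.memLp.mono_exponent le_top, hV.memL2H1⟩

theorem MemX.inL2H1 {Ω : Set Vec} {T' : ℝ} {S : ℝ → L2dev Ω} (hS : MemX T' S) :
    InL2H1 T' (fun t => (S t : L2 Ω (Fin 3 × Fin 3))) :=
  ⟨(L2dev Ω).subtypeL.comp_memLp' (hS.memLp.mono_exponent le_top), hS.memL2H1⟩

section

variable {Ω : Set Vec} {ι κ : Type} [Fintype ι] [Fintype κ] {H : Type*} [NormedAddCommGroup H]
  [InnerProductSpace ℝ H] {T' : ℝ} {u : ℝ → L2 Ω ι} {G : ℝ → L2 Ω κ} {a : Vec → H}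

theorem InL2H1.ae_integrableOn_inner_bilin (hu : InL2H1 T' u) (hΩ : IsBoundedLipschitzDomain Ω)
    (B : EuclideanSpace ℝ ι →L[ℝ] EuclideanSpace ℝ κ →L[ℝ] H) (G : ℝ → L2 Ω κ)
    (ha : MemLp a 4 (volume.restrict Ω)) :
    ∀ᵐ t ∂(volume.restrict (Ioo 0 T')),
      IntegrableOn (fun x => (inner ℝ (B (u t x) (G t x)) (a x) : ℝ)) Ω := by
  obtain ⟨K, hK⟩ := hΩ.exists_eLpNorm_inner_bilin_le B ha
  filter_upwards [hu.memL2H1.1] with t ht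
  exact memLp_one_iff_integrable.1 ⟨(B.aestronglyMeasurable_comp₂ (Lp.aestronglyMeasurable _)
    (Lp.aestronglyMeasurable _)).inner ha.1, (hK _ _ ht).trans_lt (by finiteness)⟩

theorem InL2H1.integrableOn_integral_inner_bilin (hu : InL2H1 T' u)
    (hΩ : IsBoundedLipschitzDomain Ω) (B : EuclideanSpace ℝ ι →L[ℝ] EuclideanSpace ℝ κ →L[ℝ] H)
    (hG : MemLp G 2 (volume.restrict (Ioo 0 T'))) (ha : MemLp a 4 (volume.restrict Ω))
    (ham : StronglyMeasurable a) :
    IntegrableOn (fun t => ∫ x in Ω, (inner ℝ (B (u t x) (G t x)) (a x) : ℝ)) (Ioo 0 T') := by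
  obtain ⟨K, hK⟩ := hΩ.exists_eLpNorm_inner_bilin_le B ha
  have hdom : Integrable (fun t => K * (‖u t‖ + ‖weakGrad (u t)‖) * ‖G t‖)
      (volume.restrict (Ioo 0 T')) :=
    ((hu.memLp.norm.add hu.memL2H1.2.norm).const_mul (K : ℝ)).integrable_mul hG.norm
  refine hdom.mono' (aestronglyMeasurable_integral_inner_bilin B hu.memLp.1 hG.1 ham
    (hu.ae_integrableOn_inner_bilin hΩ B G ha)) ?_
  filter_upwards [hu.memL2H1.1] with t ht
  have hle := (enorm_integral_le_lintegral_enorm _).trans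
    (eLpNorm_one_eq_lintegral_enorm.symm.trans_le (hK _ (G t) ht))
  simpa [toReal_enorm, ENNReal.toReal_add] using ENNReal.toReal_mono (by finiteness) hle

end

/-! ### The ramp -/

/-- The function that vanishes up to the time `a`, grows linearly from there on, and takes the
value `1` at the time `b`. -/
noncomputable def ramp (a b t : ℝ) : ℝ := max 0 ((t - a) / (b - a))

/-- The weak derivative of `ramp a b`. -/
noncomputable def rampDeriv (a b : ℝ) : ℝ → ℝ := (Ioi a).indicator fun _ => (b - a)⁻¹

section Ramp

variable {a b t : ℝ} {X : Type*} [NormedAddCommGroup X] [NormedSpace ℝ X]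

theorem continuous_ramp (a b : ℝ) : Continuous (ramp a b) := by
  unfold ramp
  fun_prop

theorem ramp_of_le (hab : a < b) (ht : t ≤ a) : ramp a b t = 0 :=
  max_eq_left (div_nonpos_of_nonpos_of_nonneg (sub_nonpos.2 ht) (sub_nonneg.2 hab.le))

theorem ramp_of_ge (hab : a < b) (ht : a ≤ t) : ramp a b t = (t - a) / (b - a) :=
  max_eq_right (div_nonneg (sub_nonneg.2 ht) (sub_nonneg.2 hab.le))

theorem ramp_mem_Icc (hab : a < b) (ht : t ≤ b) : ramp a b t ∈ Icc (0 : ℝ) 1 :=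
  ⟨le_max_left _ _,
    max_le zero_le_one ((div_le_one (sub_pos.2 hab)).2 (sub_le_sub_right ht a))⟩

theorem norm_ramp_le_one (hab : a < b) (ht : t ≤ b) : ‖ramp a b t‖ ≤ 1 := by
  rw [Real.norm_of_nonneg (ramp_mem_Icc hab ht).1]
  exact (ramp_mem_Icc hab ht).2

theorem aestronglyMeasurable_rampDeriv (a b : ℝ) (μ : Measure ℝ) :
    AEStronglyMeasurable (rampDeriv a b) μ :=
  (measurable_const.indicator measurableSet_Ioi).aestronglyMeasurable

theorem norm_rampDeriv_le (a b t : ℝ) : ‖rampDeriv a b t‖ ≤ ‖(b - a)⁻¹‖ :=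
  norm_indicator_le_norm_self _ _

theorem setIntegral_indicator_Ioi (ha : 0 ≤ a) (hab : a ≤ b) (f : ℝ → X) :
    ∫ t in Ioo 0 b, (Ioi a).indicator f t = ∫ t in a..b, f t := by
  rw [setIntegral_indicator measurableSet_Ioi, Ioo_inter_Ioi, max_eq_right ha,
    intervalIntegral.integral_of_le hab, integral_Ioc_eq_integral_Ioo]

theorem setIntegral_rampDeriv_smul (ha : 0 ≤ a) (hab : a ≤ b) (f : ℝ → X) :
    ∫ t in Ioo 0 b, rampDeriv a b t • f t = ⨍ t in a..b, f t := by
  rw [interval_average_eq, ← intervalIntegral.integral_smul, ← setIntegral_indicator_Ioi ha hab]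
  congr 1 with t
  by_cases ht : t ∈ Ioi a <;> simp [rampDeriv, ht]

theorem setIntegral_rampDeriv_mul_ramp (ha : 0 ≤ a) (hab : a < b) :
    ∫ t in Ioo 0 b, rampDeriv a b t * ramp a b t = 1 / 2 := by
  have hba : b - a ≠ 0 := (sub_pos.2 hab).ne'
  calc ∫ t in Ioo 0 b, rampDeriv a b t * ramp a b t
      = (b - a)⁻¹ * ∫ t in a..b, ramp a b t := by
        simpa [interval_average_eq] using setIntegral_rampDeriv_smul ha hab.le (ramp a b)
    _ = (b - a)⁻¹ * ∫ t in a..b, (t - a) / (b - a) := by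
        congr 1
        refine intervalIntegral.integral_congr fun t ht => ramp_of_ge hab ?_
        rw [uIcc_of_le hab.le] at ht
        exact ht.1
    _ = 1 / 2 := by
        rw [intervalIntegral.integral_div, intervalIntegral.integral_comp_sub_right (fun t => t),
          integral_id, sub_self]
        field_simp
        ring

theorem setIntegral_deriv_mul_ramp (ha : 0 ≤ a) (hab : a < b) {θ : ℝ → ℝ} (hθ : ContDiff ℝ 1 θ) :
    ∫ t in Ioo 0 b, deriv θ t * ramp a b t = θ b - ∫ t in Ioo 0 b, θ t * rampDeriv a b t := by
  have hba : b - a ≠ 0 := (sub_pos.2 hab).ne'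
  have hleft : ∫ t in Ioo 0 b, deriv θ t * ramp a b t =
      ∫ t in a..b, deriv θ t * ((t - a) / (b - a)) := by
    rw [← setIntegral_indicator_Ioi ha hab.le]
    congr 1 with t
    rcases le_or_gt t a with ht | ht
    · rw [indicator_of_notMem (notMem_Ioi.2 ht), ramp_of_le hab ht, mul_zero]
    · rw [indicator_of_mem (mem_Ioi.2 ht), ramp_of_ge hab ht.le]
  have hright : ∫ t in Ioo 0 b, θ t * rampDeriv a b t = ∫ t in a..b, θ t * (1 / (b - a)) := by
    rw [← setIntegral_indicator_Ioi ha hab.le]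
    congr 1 with t
    by_cases ht : t ∈ Ioi a <;> simp [rampDeriv, ht]
  have hlin (t : ℝ) : HasDerivAt (fun t => (t - a) / (b - a)) (1 / (b - a)) t :=
    ((hasDerivAt_id' t).sub_const a).div_const (b - a)
  rw [hleft, hright, intervalIntegral.integral_mul_deriv_eq_deriv_mul
    (fun t _ => (hθ.differentiable one_ne_zero t).hasDerivAt) (fun t _ => hlin t)
    ((hθ.continuous_deriv le_rfl).intervalIntegrable _ _) intervalIntegrable_const]
  simp [hba]

theorem integrableOn_ramp_mul (hab : a < b) {f : ℝ → ℝ} (hf : IntegrableOn f (Ioo 0 b)) :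
    IntegrableOn (fun t => ramp a b t * f t) (Ioo 0 b) := by
  refine hf.bdd_mul (c := 1) (continuous_ramp a b).aestronglyMeasurable ?_
  filter_upwards [ae_restrict_mem measurableSet_Ioo] with t ht
  exact norm_ramp_le_one hab ht.2.le

theorem tendsto_setIntegral_ramp_mul {f : ℝ → ℝ} (hf : IntegrableOn f (Ioo 0 b)) :
    Tendsto (fun a => ∫ t in Ioo 0 b, ramp a b t * f t) (𝓝[<] b) (𝓝 0) := by
  have h : Tendsto (fun a => ∫ t in Ioo 0 b, ramp a b t * f t) (𝓝[<] b)
      (𝓝 (∫ _ in Ioo 0 b, (0 : ℝ))) := by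
    refine tendsto_integral_filter_of_dominated_convergence (fun t => ‖f t‖)
      (Eventually.of_forall fun a => (continuous_ramp a b).aestronglyMeasurable.mul hf.1) ?_
      hf.norm ?_
    · filter_upwards [self_mem_nhdsWithin] with a hab
      filter_upwards [ae_restrict_mem measurableSet_Ioo] with t ht
      rw [norm_mul]
      exact mul_le_of_le_one_left (norm_nonneg _) (norm_ramp_le_one hab ht.2.le)
    · filter_upwards [ae_restrict_mem measurableSet_Ioo] with t ht
      refine tendsto_const_nhds.congr' ?_
      filter_upwards [Ioo_mem_nhdsLT ht.2] with a ha
      rw [ramp_of_le ha.2 ha.1.le, zero_mul]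
  simpa using h

theorem tendsto_interval_average_of_hasDerivAt {f : ℝ → X} {t₀ : ℝ} (hb : t₀ < b)
    (hf : IntervalIntegrable f volume t₀ b) {c : X}
    (h : HasDerivAt (fun x => ∫ t in t₀..x, f t) c b) :
    Tendsto (fun a => ⨍ t in a..b, f t) (𝓝[<] b) (𝓝 c) := by
  refine (h.tendsto_slope.mono_left (nhdsLT_le_nhdsNE b)).congr' ?_
  filter_upwards [Ioo_mem_nhdsLT hb] with a ha
  have hfa : IntervalIntegrable f volume t₀ a := hf.mono_set
    (uIcc_subset_uIcc_left (by rw [uIcc_of_le hb.le]; exact Ioo_subset_Icc_self ha))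
  rw [slope_comm, slope_def_module, intervalIntegral.integral_interval_sub_left hf hfa,
    interval_average_eq]

end Ramp

/-! ### The test function -/

theorem memL2H1_ramp {Ω : Set Vec} (hΩ : IsOpen Ω) {ι : Type} [Fintype ι] {A : L2 Ω ι}
    (hA : MemH1 A) {a b : ℝ} (hab : a < b) : MemL2H1 b (fun t => ramp a b t • A) := by
  refine ⟨Eventually.of_forall fun t => hA.smul _, ?_⟩
  simp only [weakGrad_smul hΩ hA]
  refine MemLp.of_bound ((continuous_ramp a b).aestronglyMeasurable.smul
    aestronglyMeasurable_const) (1 * ‖weakGrad A‖) ?_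
  filter_upwards [ae_restrict_mem measurableSet_Ioo] with t ht
  rw [norm_smul]
  gcongr
  exact norm_ramp_le_one hab ht.2.le

theorem lintegral_ramp_smul_pow_lt_top {Ω : Set Vec} {ι : Type} [Fintype ι] {A : L2 Ω ι}
    {n : ℕ} (hn : n ≠ 0) (hA : eLpNorm A n (volume.restrict Ω) < ⊤) {a b : ℝ} (hab : a < b) :
    ∫⁻ t in Ioo 0 b, ∫⁻ x in Ω, ‖(ramp a b t • A : L2 Ω ι) x‖ₑ ^ n < ⊤ := by
  have hpow : ∫⁻ x in Ω, ‖A x‖ₑ ^ n < ⊤ := by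
    simpa using lintegral_rpow_enorm_lt_top_of_eLpNorm_lt_top (Nat.cast_ne_zero.2 hn)
      (ENNReal.natCast_ne_top n) hA
  calc ∫⁻ t in Ioo 0 b, ∫⁻ x in Ω, ‖(ramp a b t • A : L2 Ω ι) x‖ₑ ^ n
      ≤ ∫⁻ _ in Ioo 0 b, ∫⁻ x in Ω, ‖A x‖ₑ ^ n := by
        refine setLIntegral_mono' measurableSet_Ioo fun t ht => lintegral_mono_ae ?_
        filter_upwards [Lp.coeFn_smul (ramp a b t) A] with x hx
        rw [hx, Pi.smul_apply, enorm_smul]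
        gcongr
        refine mul_le_of_le_one_left' ?_
        rw [← ofReal_norm]
        exact ENNReal.ofReal_le_one.2 (norm_ramp_le_one hab ht.2.le)
    _ < ⊤ := by
        rw [setLIntegral_const]
        exact ENNReal.mul_lt_top hpow measure_Ioo_lt_top

theorem memZ_ramp {Ω : Set Vec} (hΩ : IsBoundedLipschitzDomain Ω) {A : L2dev Ω}
    (hA : MemH1 (A : L2 Ω (Fin 3 × Fin 3))) {a b : ℝ} (ha : 0 ≤ a) (hab : a < b) :
    MemZ b (fun t => ramp a b t • A) (fun t => rampDeriv a b t • A) where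
  continuousOn := ((continuous_ramp a b).smul continuous_const).continuousOn
  memLp_deriv := by
    refine MemLp.of_bound ((aestronglyMeasurable_rampDeriv a b _).smul
      aestronglyMeasurable_const) (‖(b - a)⁻¹‖ * ‖A‖) (Eventually.of_forall fun t => ?_)
    rw [norm_smul]
    gcongr
    exact norm_rampDeriv_le a b t
  weakDeriv θ hθ _ hsupp := by
    have hθb : θ b = 0 := image_eq_zero_of_notMem_tsupport fun h => (hsupp h).2.false
    simp only [Submodule.coe_smul, smul_smul]
    rw [integral_smul_const, integral_smul_const,
      setIntegral_deriv_mul_ramp ha hab (hθ.of_le (by simp)), hθb, zero_sub, neg_smul]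
  memL2H1 := memL2H1_ramp hΩ.isOpen hA hab
  memL5 := lintegral_ramp_smul_pow_lt_top (n := 5) (by norm_num)
    (hA.memLp hΩ (q := 5) (by norm_num) (by norm_num)).2 hab

theorem IsPotential.map_smul_le {Ω : Set Vec} {P : L2dev Ω → ENNReal} (hP : IsPotential P)
    (A : L2dev Ω) {c : ℝ} (hc : c ∈ Icc (0 : ℝ) 1) : P (c • A) ≤ P A :=
  calc P (c • A) ≤ ENNReal.ofReal c * P A := by
        simpa [hP.map_zero] using hP.convex A 0 c hc.1 hc.2
    _ ≤ P A := mul_le_of_le_one_left' (ENNReal.ofReal_le_one.2 hc.2)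

theorem IsPotential.lintegral_ramp_le {Ω : Set Vec} {P : L2dev Ω → ENNReal} (hP : IsPotential P)
    (A : L2dev Ω) {a b : ℝ} (hab : a < b) :
    ∫⁻ t in Ioo 0 b, P (ramp a b t • A) ≤ ENNReal.ofReal (b - a) * P A := by
  calc ∫⁻ t in Ioo 0 b, P (ramp a b t • A)
      ≤ ∫⁻ t in Ioo 0 b, (Ioi a).indicator (fun _ => P A) t := by
        refine setLIntegral_mono' measurableSet_Ioo fun t ht => ?_
        rcases le_or_gt t a with hta | hta
        · rw [ramp_of_le hab hta, zero_smul, hP.map_zero]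
          exact zero_le
        · rw [indicator_of_mem (mem_Ioi.2 hta)]
          exact hP.map_smul_le A (ramp_mem_Icc hab ht.2.le)
    _ = P A * volume (Ioo 0 b ∩ Ioi a) := by
        rw [setLIntegral_indicator measurableSet_Ioi, setLIntegral_const, inter_comm]
    _ ≤ P A * volume (Ioo a b) := by
        gcongr
        exact fun t ht => ⟨ht.2, ht.1.2⟩
    _ = ENNReal.ofReal (b - a) * P A := by rw [Real.volume_Ioo, mul_comm]

/-! ### The algebraic operations as continuous (bi)linear maps -/

/-- `convect` as a continuous bilinear map. -/
noncomputable def convectL :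
    Vec →L[ℝ] EuclideanSpace ℝ ((Fin 3 × Fin 3) × Fin 3) →L[ℝ] Ten :=
  (LinearMap.mk₂ ℝ convect
    (fun v v' G => by
      ext p; simp [convect, add_mul, Finset.sum_add_distrib])
    (fun c v G => by
      ext p; simp [convect, mul_assoc, Finset.mul_sum])
    (fun v G G' => by
      ext p; simp [convect, mul_add, Finset.sum_add_distrib])
    (fun c v G => by
      ext p; simp [convect, Finset.mul_sum, mul_left_comm])).toContinuousBilinearMap

@[simp]
theorem convectL_apply (v : Vec) (G : EuclideanSpace ℝ ((Fin 3 × Fin 3) × Fin 3)) :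
    convectL v G = convect v G := rfl

/-- `(S, M) ↦ S W - W S`, with `W` the antisymmetric part of `M`, as a continuous bilinear map. -/
noncomputable def commutatorSkewL : Ten →L[ℝ] Ten →L[ℝ] Ten :=
  (LinearMap.mk₂ ℝ (fun S M => tensorCommutator S (skewPart M))
    (fun S S' M => by
      ext p
      simp only [tensorCommutator, skewPart, PiLp.add_apply, ← Finset.sum_add_distrib]
      exact Finset.sum_congr rfl fun j _ => by ring)
    (fun c S M => by
      ext p
      simp only [tensorCommutator, skewPart, PiLp.smul_apply, smul_eq_mul, Finset.mul_sum]
      exact Finset.sum_congr rfl fun j _ => by ring)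
    (fun S M M' => by
      ext p
      simp only [tensorCommutator, skewPart, PiLp.add_apply, ← Finset.sum_add_distrib]
      exact Finset.sum_congr rfl fun j _ => by ring)
    (fun c S M => by
      ext p
      simp only [tensorCommutator, skewPart, PiLp.smul_apply, smul_eq_mul, Finset.mul_sum]
      exact Finset.sum_congr rfl fun j _ => by ring)).toContinuousBilinearMap

@[simp]
theorem commutatorSkewL_apply (S M : Ten) :
    commutatorSkewL S M = tensorCommutator S (skewPart M) := rfl

/-- `symPart` as a continuous linear map. -/
noncomputable def symPartL : Ten →L[ℝ] Ten :=
  LinearMap.toContinuousLinearMap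
    { toFun := symPart
      map_add' := fun M N => by
        ext p; simp only [symPart, PiLp.add_apply]; ring
      map_smul' := fun c M => by
        ext p; simp only [symPart, PiLp.smul_apply, smul_eq_mul, RingHom.id_apply]; ring }

/-! ### The variational inequality, tested with a multiple of a fixed field -/

section

variable {α E : Type*} [MeasurableSpace α] {μ : Measure α} [NormedAddCommGroup E]
  [InnerProductSpace ℝ E]

theorem integrable_inner_sub (f g h : Lp E 2 μ) :
    Integrable (fun x => (inner ℝ (f x) (g x - h x) : ℝ)) μ := by
  refine (L2.integrable_inner (𝕜 := ℝ) f (g - h)).congr ?_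
  filter_upwards [Lp.coeFn_sub g h] with x hx
  rw [hx, Pi.sub_apply]

theorem integral_inner_sub (f g h : Lp E 2 μ) :
    ∫ x, (inner ℝ (f x) (g x - h x) : ℝ) ∂μ = inner ℝ f g - inner ℝ f h := by
  rw [← inner_sub_right, L2.inner_def]
  refine integral_congr_ae ?_
  filter_upwards [Lp.coeFn_sub g h] with x hx
  rw [hx, Pi.sub_apply]

theorem integrable_inner_of_memLp {f g : α → E} (hf : MemLp f 2 μ) (hg : MemLp g 2 μ) :
    Integrable (fun t => (inner ℝ (f t) (g t) : ℝ)) μ :=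
  (hf.norm.integrable_mul hg.norm).mono' (hf.1.inner hg.1)
    (Eventually.of_forall fun _ => norm_inner_le_norm _ _)

end

section

variable {Ω : Set Vec}

/-- The field `D(v)` of symmetric gradients. -/
noncomputable def symGrad (v : L2 Ω (Fin 3)) : L2 Ω (Fin 3 × Fin 3) :=
  symPartL.compLpL 2 (volume.restrict Ω) (weakGrad v)

theorem coeFn_symGrad (v : L2 Ω (Fin 3)) :
    symGrad v =ᵐ[volume.restrict Ω] fun x => symPart (weakGrad v x) :=
  symPartL.coeFn_compLp (weakGrad v)

theorem InL2H1.memLp_symGrad {T' : ℝ} {V : ℝ → L2 Ω (Fin 3)} (hV : InL2H1 T' V) :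
    MemLp (fun t => symGrad (V t)) 2 (volume.restrict (Ioo 0 T')) :=
  (symPartL.compLpL 2 (volume.restrict Ω)).comp_memLp' hV.memL2H1.2

/-- The terms `V · ∇S : A + (S W(V) - W(V) S) : A`, integrated over `Ω`. -/
noncomputable def transport (v : L2 Ω (Fin 3)) (S A : L2 Ω (Fin 3 × Fin 3)) : ℝ :=
  (∫ x in Ω, inner ℝ (convectL (v x) (weakGrad S x)) (A x)) +
    ∫ x in Ω, inner ℝ (commutatorSkewL (S x) (weakGrad v x)) (A x)

theorem integral_mul_inner_symPart (η : ℝ) (v : L2 Ω (Fin 3)) (S : L2 Ω (Fin 3 × Fin 3)) :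
    ∫ x in Ω, η * inner ℝ (symPart (weakGrad v x)) (S x) = η * inner ℝ (symGrad v) S := by
  rw [integral_const_mul, L2.inner_def]
  congr 1
  refine integral_congr_ae ?_
  filter_upwards [coeFn_symGrad v] with x hx
  rw [hx]

theorem integral_dissipation_smul (hΩ : IsOpen Ω) (γ c d : ℝ) (S : L2 Ω (Fin 3 × Fin 3))
    {A : L2 Ω (Fin 3 × Fin 3)} (hA : MemH1 A) :
    ∫ x in Ω, (inner ℝ ((d • A : L2 Ω (Fin 3 × Fin 3)) x)
        ((c • A : L2 Ω (Fin 3 × Fin 3)) x - S x) +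
      γ * inner ℝ (weakGrad S x) (weakGrad (c • A) x - weakGrad S x)) =
    d * c * ‖A‖ ^ 2 + c * (γ * inner ℝ (weakGrad S) (weakGrad A)) -
      (inner ℝ A (d • S) + γ * ‖weakGrad S‖ ^ 2) := by
  rw [integral_add (integrable_inner_sub (d • A) (c • A) S)
    ((integrable_inner_sub (weakGrad S) (weakGrad (c • A)) (weakGrad S)).const_mul γ),
    integral_const_mul, integral_inner_sub, integral_inner_sub, weakGrad_smul hΩ hA]
  simp only [real_inner_smul_left, real_inner_smul_right, real_inner_self_eq_norm_sq]
  ring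

theorem integral_transport_smul (η c : ℝ) {v : L2 Ω (Fin 3)} {S A : L2 Ω (Fin 3 × Fin 3)}
    (hconvect : IntegrableOn (fun x => inner ℝ (convectL (v x) (weakGrad S x)) (A x)) Ω)
    (hcommutator :
      IntegrableOn (fun x => inner ℝ (commutatorSkewL (S x) (weakGrad v x)) (A x)) Ω) :
    ∫ x in Ω, (inner ℝ (convect (v x) (weakGrad S x)) ((c • A : L2 Ω (Fin 3 × Fin 3)) x)
        + inner ℝ (tensorCommutator (S x) (skewPart (weakGrad v x)))
            ((c • A : L2 Ω (Fin 3 × Fin 3)) x)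
        - η * inner ℝ (symPart (weakGrad v x)) ((c • A : L2 Ω (Fin 3 × Fin 3)) x - S x)) =
      c * (transport v S A - η * inner ℝ (symGrad v) A) + η * inner ℝ (symGrad v) S := by
  calc _ = ∫ x in Ω, (c * inner ℝ (convectL (v x) (weakGrad S x)) (A x)
        + c * inner ℝ (commutatorSkewL (S x) (weakGrad v x)) (A x)
        - η * inner ℝ (symGrad v x) ((c • A : L2 Ω (Fin 3 × Fin 3)) x - S x)) := by
        refine integral_congr_ae ?_
        filter_upwards [Lp.coeFn_smul c A, coeFn_symGrad v] with x hA hv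
        rw [hv, hA]
        simp only [Pi.smul_apply, real_inner_smul_right, convectL_apply, commutatorSkewL_apply]
    _ = _ := by
        rw [integral_sub ((hconvect.const_mul c).fun_add (hcommutator.const_mul c))
            ((integrable_inner_sub (symGrad v) (c • A) S).const_mul η),
          integral_add (hconvect.const_mul c) (hcommutator.const_mul c)]
        simp only [integral_const_mul, integral_inner_sub, real_inner_smul_right, transport]
        ring

end

section

variable {Ω : Set Vec} {a b : ℝ} {V : ℝ → L2 Ω (Fin 3)}

theorem InL2H1.integral_dissipation_ramp {S : ℝ → L2 Ω (Fin 3 × Fin 3)} (hS : InL2H1 b S)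
    (hΩ : IsOpen Ω) (γ : ℝ) {A : L2 Ω (Fin 3 × Fin 3)} (hA : MemH1 A) (ha : 0 ≤ a) (hab : a < b) :
    ∫ t in Ioo 0 b, ∫ x in Ω,
      (inner ℝ ((rampDeriv a b t • A : L2 Ω (Fin 3 × Fin 3)) x)
          ((ramp a b t • A : L2 Ω (Fin 3 × Fin 3)) x - S t x)
        + γ * inner ℝ (weakGrad (S t) x) (weakGrad (ramp a b t • A) x - weakGrad (S t) x)) =
    1 / 2 * ‖A‖ ^ 2 + (∫ t in Ioo 0 b, ramp a b t * (γ * inner ℝ (weakGrad (S t)) (weakGrad A)))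
      - (inner ℝ A (⨍ t in a..b, S t) + γ * ∫ t in Ioo 0 b, ‖weakGrad (S t)‖ ^ 2) := by
  have hderiv_le : ∀ᵐ t ∂(volume.restrict (Ioo 0 b)), ‖rampDeriv a b t‖ ≤ ‖(b - a)⁻¹‖ :=
    Eventually.of_forall (norm_rampDeriv_le a b)
  have hderiv := aestronglyMeasurable_rampDeriv a b (volume.restrict (Ioo 0 b))
  have hsq : IntegrableOn (fun t => rampDeriv a b t * ramp a b t * ‖A‖ ^ 2) (Ioo 0 b) :=
    (((integrableOn_ramp_mul hab (integrable_const 1)).bdd_mul hderiv hderiv_le).mul_const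
      (‖A‖ ^ 2)).congr (Eventually.of_forall fun t => by simp only [mul_one])
  have hmean : IntegrableOn (fun t => rampDeriv a b t • S t) (Ioo 0 b) :=
    (hS.memLp.integrable one_le_two).bdd_smul _ hderiv hderiv_le
  have hgrad : IntegrableOn (fun t => ramp a b t * (γ * inner ℝ (weakGrad (S t)) (weakGrad A)))
      (Ioo 0 b) :=
    integrableOn_ramp_mul hab
      ((integrable_inner_of_memLp hS.memL2H1.2 (memLp_const _)).const_mul γ)
  have hgrad_sq : IntegrableOn (fun t => γ * ‖weakGrad (S t)‖ ^ 2) (Ioo 0 b) :=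
    (hS.memL2H1.2.integrable_norm_pow two_ne_zero).const_mul γ
  simp only [integral_dissipation_smul hΩ _ _ _ _ hA]
  rw [integral_sub (hsq.fun_add hgrad) ((hmean.const_inner A).fun_add hgrad_sq),
    integral_add hsq hgrad, integral_add (hmean.const_inner A) hgrad_sq, integral_inner hmean,
    integral_mul_const, integral_const_mul, setIntegral_rampDeriv_smul ha hab.le,
    setIntegral_rampDeriv_mul_ramp ha hab]

variable {S : ℝ → L2 Ω (Fin 3 × Fin 3)} {A : L2 Ω (Fin 3 × Fin 3)}

theorem integrableOn_transport (hΩ : IsBoundedLipschitzDomain Ω) (hV : InL2H1 b V)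
    (hS : InL2H1 b S) (hA : MemH1 A) :
    IntegrableOn (fun t => transport (V t) (S t) A) (Ioo 0 b) := by
  have hA4 : MemLp A 4 (volume.restrict Ω) :=
    hA.memLp hΩ (q := 4) (by norm_num) (by norm_num)
  exact (hV.integrableOn_integral_inner_bilin hΩ convectL hS.memL2H1.2 hA4
      (Lp.stronglyMeasurable A)).add
    (hS.integrableOn_integral_inner_bilin hΩ commutatorSkewL hV.memL2H1.2 hA4
      (Lp.stronglyMeasurable A))

theorem integrableOn_transport_sub (hΩ : IsBoundedLipschitzDomain Ω) (hV : InL2H1 b V)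
    (hS : InL2H1 b S) (hA : MemH1 A) (η : ℝ) :
    IntegrableOn (fun t => transport (V t) (S t) A - η * inner ℝ (symGrad (V t)) A) (Ioo 0 b) :=
  (integrableOn_transport hΩ hV hS hA).sub
    ((integrable_inner_of_memLp hV.memLp_symGrad (memLp_const A)).const_mul η)

theorem integral_transport_ramp (hΩ : IsBoundedLipschitzDomain Ω) (hV : InL2H1 b V)
    (hS : InL2H1 b S) (hA : MemH1 A) (η : ℝ) (hab : a < b) :
    ∫ t in Ioo 0 b, ∫ x in Ω,
      (inner ℝ (convect (V t x) (weakGrad (S t) x)) ((ramp a b t • A : L2 Ω (Fin 3 × Fin 3)) x)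
        + inner ℝ (tensorCommutator (S t x) (skewPart (weakGrad (V t) x)))
          ((ramp a b t • A : L2 Ω (Fin 3 × Fin 3)) x)
        - η * inner ℝ (symPart (weakGrad (V t) x))
          ((ramp a b t • A : L2 Ω (Fin 3 × Fin 3)) x - S t x)) =
    (∫ t in Ioo 0 b, ramp a b t * (transport (V t) (S t) A - η * inner ℝ (symGrad (V t)) A))
      + ∫ t in Ioo 0 b, η * inner ℝ (symGrad (V t)) (S t) := by
  have hA4 : MemLp A 4 (volume.restrict Ω) :=
    hA.memLp hΩ (q := 4) (by norm_num) (by norm_num)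
  rw [← integral_add (integrableOn_ramp_mul hab (integrableOn_transport_sub hΩ hV hS hA η))
    ((integrable_inner_of_memLp hV.memLp_symGrad hS.memLp).const_mul η)]
  refine integral_congr_ae ?_
  filter_upwards [hV.ae_integrableOn_inner_bilin hΩ convectL (fun t => weakGrad (S t)) hA4,
    hS.ae_integrableOn_inner_bilin hΩ commutatorSkewL (fun t => weakGrad (V t)) hA4]
    with t hconvect hcommutator
  exact integral_transport_smul η (ramp a b t) hconvect hcommutator

end

/-! ### The energy inequality -/

section

variable {Ω : Set Vec} {η γ a b : ℝ} {P : L2dev Ω → ENNReal} {S₀ : L2dev Ω}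
  {V : ℝ → L2 Ω (Fin 3)} {S : ℝ → L2dev Ω}

theorem VariationalIneq.lintegral_potential_ne_top {R dR : ℝ → L2dev Ω}
    (h : VariationalIneq η γ P S₀ V S b R dR) (hR : ∫⁻ t in Ioo 0 b, P (R t) ≠ ⊤) :
    ∫⁻ t in Ioo 0 b, P (S t) ≠ ⊤ := by
  rw [← EReal.coe_ennreal_ne_coe_ennreal_iff, EReal.coe_ennreal_top] at hR ⊢
  exact (h.trans_lt (EReal.add_lt_top hR (EReal.coe_ne_top _))).ne

theorem IsPotential.ae_lt_top (hP : IsPotential P)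
    (hS : InL2H1 b (fun t => (S t : L2 Ω (Fin 3 × Fin 3))))
    (hfin : ∫⁻ t in Ioo 0 b, P (S t) ≠ ⊤) :
    ∀ᵐ t ∂(volume.restrict (Ioo 0 b)), P (S t) < ⊤ := by
  let _ : MeasurableSpace (L2dev Ω) := borel _
  have : BorelSpace (L2dev Ω) := ⟨rfl⟩
  have hSmeas : AEStronglyMeasurable S (volume.restrict (Ioo 0 b)) :=
    IsEmbedding.subtypeVal.aestronglyMeasurable_comp_iff.1 hS.memLp.aestronglyMeasurable
  exact ae_lt_top' (hP.lowerSemicontinuous.measurable.comp_aemeasurable hSmeas.aemeasurable) hfin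

theorem VariationalIneq.lintegral_potential_le (hΩ : IsBoundedLipschitzDomain Ω)
    (hP : IsPotential P) (hV : InL2H1 b V)
    (hS : InL2H1 b (fun t => (S t : L2 Ω (Fin 3 × Fin 3)))) {A : L2dev Ω}
    (hA : MemH1 (A : L2 Ω (Fin 3 × Fin 3))) (hPA : P A ≠ ⊤) (ha : 0 ≤ a) (hab : a < b)
    (h : VariationalIneq η γ P S₀ V S b
      (fun t => ramp a b t • A) (fun t => rampDeriv a b t • A)) :
    ((∫⁻ t in Ioo 0 b, P (S t) : ENNReal) : EReal) ≤
      (((b - a) * (P A).toReal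
        + (1 / 2 * ‖A‖ ^ 2
          + (∫ t in Ioo 0 b, ramp a b t *
              (γ * inner ℝ (weakGrad (S t : L2 Ω (Fin 3 × Fin 3))) (weakGrad A.1)))
          - (inner ℝ A.1 (⨍ t in a..b, (S t : L2 Ω (Fin 3 × Fin 3)))
            + γ * ∫ t in Ioo 0 b, ‖weakGrad (S t : L2 Ω (Fin 3 × Fin 3))‖ ^ 2)
          + ((∫ t in Ioo 0 b, ramp a b t *
              (transport (V t) (S t) A - η * inner ℝ (symGrad (V t)) A.1))
            + ∫ t in Ioo 0 b, η * inner ℝ (symGrad (V t)) (S t : L2 Ω (Fin 3 × Fin 3)))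
          + 1 / 2 * ‖S₀‖ ^ 2) : ℝ) : EReal) := by
  have hPramp : ((∫⁻ t in Ioo 0 b, P (ramp a b t • A) : ENNReal) : EReal) ≤
      (((b - a) * (P A).toReal : ℝ) : EReal) := by
    refine (EReal.coe_ennreal_le_coe_ennreal_iff.2 (hP.lintegral_ramp_le A hab)).trans_eq ?_
    rw [EReal.coe_ennreal_mul, EReal.coe_ennreal_ofReal, max_eq_left (sub_pos.2 hab).le,
      ← EReal.coe_ennreal_toReal hPA, EReal.coe_mul]
  have hzero : ramp a b 0 • A - S₀ = -S₀ := by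
    rw [ramp_of_le hab ha, zero_smul, zero_sub]
  refine (h.trans (add_le_add_left hPramp _)).trans_eq ?_
  simp only [Submodule.coe_smul]
  rw [hzero, norm_neg, hS.integral_dissipation_ramp hΩ.isOpen γ hA ha hab,
    integral_transport_ramp hΩ hV hS hA η hab, ← EReal.coe_add]
  rfl

theorem energy_inequality_at (hΩ : IsBoundedLipschitzDomain Ω) (hP : IsPotential P) (hb : 0 < b)
    (hV : InL2H1 b V) (hS : InL2H1 b (fun t => (S t : L2 Ω (Fin 3 × Fin 3))))
    (hH1 : MemH1 (S b : L2 Ω (Fin 3 × Fin 3))) (hPS : P (S b) ≠ ⊤)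
    (hderiv : HasDerivAt (fun t => ∫ τ in (0 : ℝ)..t, (S τ : L2 Ω (Fin 3 × Fin 3))) (S b).1 b)
    (hvar : ∀ a ∈ Ico 0 b, VariationalIneq η γ P S₀ V S b
      (fun t => ramp a b t • S b) (fun t => rampDeriv a b t • S b)) :
    ((1 / 2 * ‖S b‖ ^ 2
        + γ * ∫ t in Ioo 0 b, ‖weakGrad (S t : L2 Ω (Fin 3 × Fin 3))‖ ^ 2 : ℝ) : EReal)
      + ((∫⁻ t in Ioo 0 b, P (S t) : ENNReal) : EReal) ≤
    ((1 / 2 * ‖S₀‖ ^ 2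
        + ∫ t in Ioo 0 b, ∫ x in Ω, η * inner ℝ (symPart (weakGrad (V t) x))
            ((S t : L2 Ω (Fin 3 × Fin 3)) x) : ℝ) : EReal) := by
  simp only [integral_mul_inner_symPart]
  have hSint : IntervalIntegrable (fun t => (S t : L2 Ω (Fin 3 × Fin 3))) volume 0 b :=
    (intervalIntegrable_iff_integrableOn_Ioo_of_le hb.le).2 (hS.memLp.integrable one_le_two)
  have hlength : Tendsto (fun a => b - a) (𝓝[<] b) (𝓝 0) :=
    tendsto_nhdsWithin_of_tendsto_nhds
      ((continuous_const.sub continuous_id).tendsto' b 0 (sub_self b))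
  have hmean := tendsto_interval_average_of_hasDerivAt hb hSint hderiv
  have hgrad := tendsto_setIntegral_ramp_mul
    ((integrable_inner_of_memLp hS.memL2H1.2 (memLp_const (weakGrad (S b).1))).const_mul γ)
  have htransport := tendsto_setIntegral_ramp_mul (integrableOn_transport_sub hΩ hV hS hH1 η)
  set D := ∫ t in Ioo 0 b, η * inner ℝ (symGrad (V t)) (S t : L2 Ω (Fin 3 × Fin 3))
  set G := ∫ t in Ioo 0 b, ‖weakGrad (S t : L2 Ω (Fin 3 × Fin 3))‖ ^ 2
  have hdissipation := (hgrad.const_add (1 / 2 * ‖S b‖ ^ 2)).sub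
    ((Tendsto.inner (𝕜 := ℝ) (tendsto_const_nhds (x := (S b).1)) hmean).add_const (γ * G))
  have hlim := (hlength.mul_const (P (S b)).toReal).add
    ((hdissipation.add (htransport.add_const D)).add_const (1 / 2 * ‖S₀‖ ^ 2))
  have hbound := ge_of_tendsto ((continuous_coe_real_ereal.tendsto _).comp hlim) (by
    filter_upwards [Ico_mem_nhdsLT hb] with a ha
    exact (hvar a ha).lintegral_potential_le hΩ hP hV hS hH1 hPS ha.1 ha.2)
  refine (add_le_add_right hbound _).trans_eq ?_
  rw [← EReal.coe_add, real_inner_self_eq_norm_sq, ← Submodule.coe_norm]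
  congr 1
  ring

end

theorem ae_restrict_timeInterval {T : EReal} {p : ℝ → Prop}
    (h : ∀ T' ∈ timeInterval T, ∀ᵐ t ∂(volume.restrict (Ioo 0 T')), p t) :
    ∀ᵐ t ∂(volume.restrict (timeInterval T)), p t := by
  have hsub : timeInterval T ⊆ ⋃ q ∈ {q : ℚ | (q : ℝ) ∈ timeInterval T}, Ioo (0 : ℝ) q := by
    intro t ht
    obtain ⟨q, htq, hqT⟩ := EReal.lt_iff_exists_rat_btwn.1 ht.2
    have htq' : t < (q : ℝ) := EReal.coe_lt_coe_iff.1 htq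
    exact mem_iUnion₂.2 ⟨q, ⟨ht.1.trans htq', hqT⟩, ht.1, htq'⟩
  refine ae_restrict_of_ae_restrict_of_subset hsub ?_
  rw [ae_restrict_biUnion_iff _ (to_countable _)]
  exact fun q hq => h q hq

end ViscoFluid

theorem proposition3p1_general {Ω : Set Vec} (hΩ : IsBoundedLipschitzDomain Ω) {T : EReal}
    {η γ : ℝ} {P : L2dev Ω → ENNReal} (hP : IsPotential P) {S₀ : L2dev Ω}
    {V : ℝ → L2 Ω (Fin 3)} {S : ℝ → L2dev Ω}
    (hV : ∀ T' ∈ timeInterval T, InL2H1 T' V)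
    (hS : ∀ T' ∈ timeInterval T, InL2H1 T' (fun t => (S t : L2 Ω (Fin 3 × Fin 3))))
    (hvar : ∀ T' ∈ timeInterval T, ∀ A : L2dev Ω, MemH1 (A : L2 Ω (Fin 3 × Fin 3)) →
      ∀ a ∈ Ico 0 T', VariationalIneq η γ P S₀ V S T'
        (fun t => ramp a T' t • A) (fun t => rampDeriv a T' t • A)) :
    ∀ᵐ T' ∂(volume.restrict (timeInterval T)),
      ((1 / 2 * ‖S T'‖ ^ 2
          + γ * ∫ t in Ioo 0 T', ‖weakGrad (S t : L2 Ω (Fin 3 × Fin 3))‖ ^ 2 : ℝ) : EReal)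
        + ((∫⁻ t in Ioo 0 T', P (S t) : ENNReal) : EReal) ≤
      ((1 / 2 * ‖S₀‖ ^ 2
          + ∫ t in Ioo 0 T', ∫ x in Ω, η * inner ℝ (symPart (weakGrad (V t) x))
              ((S t : L2 Ω (Fin 3 × Fin 3)) x) : ℝ) : EReal) := by
  refine ae_restrict_timeInterval fun τ hτ => ?_
  have hfin : ∫⁻ t in Ioo 0 τ, P (S t) ≠ ⊤ :=
    (hvar τ hτ 0 ⟨0, isWeakGrad_zero⟩ 0 ⟨le_rfl, hτ.1⟩).lintegral_potential_ne_top
      (by simp [hP.map_zero])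
  have hSint : IntervalIntegrable (fun t => (S t : L2 Ω (Fin 3 × Fin 3))) volume 0 τ :=
    (intervalIntegrable_iff_integrableOn_Ioo_of_le hτ.1.le).2
      ((hS τ hτ).memLp.integrable one_le_two)
  filter_upwards [(hS τ hτ).memL2H1.1, hP.ae_lt_top (hS τ hτ) hfin,
    ae_restrict_of_ae hSint.ae_hasDerivAt_integral, ae_restrict_mem measurableSet_Ioo]
    with T' hH1 hPS hderiv hT'
  have hmem : T' ∈ timeInterval T := ⟨hT'.1, (EReal.coe_lt_coe_iff.2 hT'.2).trans hτ.2⟩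
  rw [uIcc_of_le hτ.1.le] at hderiv
  exact energy_inequality_at hΩ hP hT'.1 (hV T' hmem) (hS T' hmem) hH1 hPS.ne
    (hderiv (Ioo_subset_Icc_self hT') 0 (left_mem_Icc.2 hτ.1.le)) (hvar T' hmem (S T') hH1)

theorem proposition3p1 (Ω : Set Vec) (hΩ : IsBoundedLipschitzDomain Ω)
    (T : EReal) (hT : 0 < T) (η μ γ : ℝ) (hη : 0 < η) (hμ : 0 < μ) (hγ : 0 < γ)
    (P : L2dev Ω → ENNReal) (hP : IsPotential P)
    (V₀ : L2 Ω (Fin 3)) (hV₀ : IsSolenoidal V₀) (S₀ : L2dev Ω)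
    (F₀ : ℝ → L2 Ω (Fin 3))
    (hF₀ : ∀ T' ∈ timeInterval T, MemLp F₀ 1 (volume.restrict (Ioo 0 T')))
    (F₁ : ℝ → L2 Ω (Fin 3 × Fin 3))
    (hF₁ : ∀ T' ∈ timeInterval T, MemLp F₁ 2 (volume.restrict (Ioo 0 T')))
    (g : ℝ → Lp Vec 2 (surfaceMeasure Ω))
    (V : ℝ → L2 Ω (Fin 3)) (S : ℝ → L2dev Ω)
    (hsol : IsGeneralizedSolution T η μ γ P V₀ S₀ F₀ F₁ g V S) :
    ∀ᵐ T' ∂(volume.restrict (timeInterval T)),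
      ((1 / 2 * ‖S T'‖ ^ 2
          + γ * ∫ t in Ioo 0 T', ‖weakGrad (S t : L2 Ω (Fin 3 × Fin 3))‖ ^ 2 : ℝ) : EReal)
        + ((∫⁻ t in Ioo 0 T', P (S t) : ENNReal) : EReal) ≤
      ((1 / 2 * ‖S₀‖ ^ 2
          + ∫ t in Ioo 0 T', ∫ x in Ω, η * inner ℝ (symPart (weakGrad (V t) x))
              ((S t : L2 Ω (Fin 3 × Fin 3)) x) : ℝ) : EReal) := by
  exact proposition3p1_general hΩ hP (fun T' hT' => (hsol.memLH T' hT').inL2H1)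
    (fun T' hT' => (hsol.memX T' hT').inL2H1)
    fun T' hT' _ hA _ ha => hsol.variational T' hT' _ _ (memZ_ramp hΩ hA ha.1 ha.2)
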